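/- Let $k$ be a field of characteristic $0$ and let $B_n=\langle\sigma_1,\dots,\sigma_{n-1}\rangle$ be the braid group on $n$ strands. For a finite quotient $B_n\twoheadrightarrow Q$ the group algebra $k[Q]$ is a right $k[B_n]$-module; these modules form an inverse system $\widehat{\mathrm{BrAss}}(n)=\{k[Q]\}_Q$ over all finite quotients $Q$ of $B_n$ (pro-objects are taken in right $k[B_n]$-modules). Let $\widetilde\tau\in B_n$ be the Matsumoto lift of $\tau\in S_n$ (write $\tau$ as a word of minimal length in the adjacent transpositions $(i,i+1)$ and replace each of them by $\sigma_i$), and put $$\mathfrak S_{p,q}=\sum_{\tau}\widetilde\tau\in k[B_{p+q}],\qquad \mathfrak S_n=\sum_{\tau\in S_n}\widetilde\tau\in k[B_n],$$ where the first sum is over the $(p,q)$-unshuffles $\tau$, i.e. those $\tau\in S_{p+q}$ for which $\tau^{-1}$ is increasing on $\{1,\dots,p\}$ and on $\{p+1,\dots,p+q\}$. Define sub-inverse systems of $\widehat{\mathrm{BrAss}}(n)$ by $$\mathrm{BrPrim}(n)_Q=\bigcap_{p+q=n,\;p,q>0}\ker\big(\mathfrak S_{p,q}\cdot-:k[Q]\to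 k[Q]\big)\ (n\ge 2),\qquad \mathrm{BrPrim}(0)=\mathrm{BrPrim}(1)=0,$$ $$\mathfrak W(n)_Q=\ker\big(\mathfrak S_n\cdot-:k[Q]\to k[Q]\big).$$ Let $\circ_i$ denote the operadic compositions of $\widehat{\mathrm{BrAss}}$, induced by the cabling maps $\circ_i:B_m\times B_l\to B_{m+l-1}$ (replace the $i$-th strand of the first braid by a tube filled with the second braid). For $(\mathcal C,\mathcal M)=(\mathrm{BrPrim},\mathrm{BrPrim})$ or $(\widehat{\mathrm{BrAss}}_{>1},\mathfrak W)$, where $\widehat{\mathrm{BrAss}}_{>1}$ is the part of $\widehat{\mathrm{BrAss}}$ in arities $>1$, the indecomposables $Q_{\mathcal C}(\mathcal M)(n)$ are the cokernel (as a pro-object) of $$\sum_{m=2}^{n-1}\sum_{i=1}^m\circ_i:\ \bigoplus_{m,i}\mathrm{Ind}_{B_m^i\times B_{n-m+1}}^{B_n}\big(\mathcal C(m)\otimes\mathcal M(n-m+1)\big)\to\mathcal M(n),$$ where $B_m^i\le B_m$ is the subgroup of braids whose permutation fixes $i$. Write $Q(\mathrm{BrPrim})=Q_{\mathrm{BrPrim}}(\mathrm{BrPrim})$.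 An inverse system $V=\{V_j\}_{j\in J}$ of right $k[B_n]$-modules is *pro-cyclic*, with generator $v\in\varprojlim_j V_j$, if the image of $v$ in $V_h$ generates the $k[B_n]$-module $V_h$ for all $h$ in a cofinal subsystem of $J$. **Theorem.** Let $n\ge 2$. 1. $\mathrm{BrPrim}(n)$ and $Q(\mathrm{BrPrim})(n)$ are nonzero as pro-objects and pro-cyclic. For every finite quotient $Q$ of $B_n$ there is a unique idempotent $g_{n,Q}\in k[Q]$ with $g_{n,Q}\,k[Q]=\mathrm{BrPrim}(n)_Q$ that is fixed by the antipode of $k[Q]$ (the linear map inverting group elements); the $g_{n,Q}$ are compatible and define the braided Garsia idempotent $g_n\in\varprojlim_Q\mathrm{BrPrim}(n)_Q$. This $g_n$ is a generator of $\mathrm{BrPrim}(n)$, and its image in $\varprojlim Q(\mathrm{BrPrim})(n)$ is nonzero and a generator of $Q(\mathrm{BrPrim})(n)$. In particular $\mathrm{BrPrim}$ has indecomposable operations in every arity $n\ge 2$. 2. $\mathfrak W(n)$ and $Q_{\widehat{\mathrm{BrAss}}_{>1}}(\mathfrak W)(n)$ are nonzero as pro-objects and pro-cyclic. The unique antipode-fixed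 idempotents $h_{n,Q}\in k[Q]$ with $h_{n,Q}\,k[Q]=\mathfrak W(n)_Q$ exist for every finite quotient $Q$ of $B_n$, are compatible, and define $h_n\in\varprojlim_Q\mathfrak W(n)_Q$; this $h_n$ is a generator of $\mathfrak W(n)$, and its image in $\varprojlim Q_{\widehat{\mathrm{BrAss}}_{>1}}(\mathfrak W)(n)$ is nonzero and a generator of $Q_{\widehat{\mathrm{BrAss}}_{>1}}(\mathfrak W)(n)$. -/

import Mathlib

open CategoryTheory MulOpposite

/-! ### Braid groups -/

/-- The defining relators of the braid group on `n` strands; the `n - 1` generators are numbered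
from `0`, generator `j` being the crossing of the strands `j` and `j + 1`. -/
inductive BraidRel (n : ℕ) : FreeGroup (Fin (n - 1)) → Prop
  | braid (i j : Fin (n - 1)) (h : (i : ℕ) + 1 = j) :
      BraidRel n (FreeGroup.of i * FreeGroup.of j * FreeGroup.of i *
        (FreeGroup.of j * FreeGroup.of i * FreeGroup.of j)⁻¹)
  | comm (i j : Fin (n - 1)) (h : (i : ℕ) + 1 < j) :
      BraidRel n (FreeGroup.of i * FreeGroup.of j * (FreeGroup.of j * FreeGroup.of i)⁻¹)

/-- The braid group on `n` strands (trivial for `n = 0, 1`), by Artin's presentation. -/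
abbrev BraidGroup (n : ℕ) : Type := PresentedGroup {r | BraidRel n r}

/-- The generator crossing the strands `j` and `j + 1` (counted from `0`), set to be `1` when
there are no such strands. -/
def braidGen (n j : ℕ) : BraidGroup n :=
  if h : j < n - 1 then PresentedGroup.of ⟨j, h⟩ else 1

theorem braidGen_braid {n j : ℕ} (h : j + 1 < n - 1) :
    braidGen n j * braidGen n (j + 1) * braidGen n j =
      braidGen n (j + 1) * braidGen n j * braidGen n (j + 1) := by
  have h0 : j < n - 1 := by omega
  have := PresentedGroup.one_of_mem (rels := {r | BraidRel n r})
    (BraidRel.braid ⟨j, h0⟩ ⟨j + 1, h⟩ rfl)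
  simp only [map_mul, map_inv] at this
  simp only [braidGen, dif_pos h0, dif_pos h]
  exact mul_inv_eq_one.1 this

theorem braidGen_comm {n i j : ℕ} (h : i + 1 < j) :
    braidGen n i * braidGen n j = braidGen n j * braidGen n i := by
  by_cases hj : j < n - 1
  · have hi : i < n - 1 := by omega
    have := PresentedGroup.one_of_mem (rels := {r | BraidRel n r})
      (BraidRel.comm ⟨i, hi⟩ ⟨j, hj⟩ h)
    simp only [map_mul, map_inv] at this
    simp only [braidGen, dif_pos hi, dif_pos hj]
    exact mul_inv_eq_one.1 this
  · simp [braidGen, dif_neg hj]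

/-- A homomorphism out of the braid group from images of the generators that satisfy the braid
relations. -/
def braidLift {n : ℕ} {G : Type*} [Group G] (f : ℕ → G)
    (hb : ∀ j, j + 1 < n - 1 → f j * f (j + 1) * f j = f (j + 1) * f j * f (j + 1))
    (hc : ∀ i j, i + 1 < j → j < n - 1 → f i * f j = f j * f i) : BraidGroup n →* G :=
  PresentedGroup.toGroup (f := fun j : Fin (n - 1) => f j) (by
    rintro r (⟨i, j, h⟩ | ⟨i, j, h⟩)
    · simp only [map_mul, map_inv, FreeGroup.lift_apply_of, mul_inv_eq_one, ← h]
      exact hb i (h ▸ j.2)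
    · simp only [map_mul, map_inv, FreeGroup.lift_apply_of, mul_inv_eq_one]
      exact hc i j h j.2)

/-! ### Cabling -/

/-- `σ_j σ_{j+1} ⋯ σ_{j+l-1}`: a cable of `l` strands at `j, …, j+l-1` crosses the strand `j+l`. -/
def cableUp (n j : ℕ) : ℕ → BraidGroup n
  | 0 => 1
  | l + 1 => cableUp n j l * braidGen n (j + l)

/-- `σ_{j+l-1} ⋯ σ_{j+1} σ_j`: the strand `j` crosses a cable of `l` strands at `j+1, …, j+l`. -/
def cableDown (n j : ℕ) : ℕ → BraidGroup n
  | 0 => 1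
  | l + 1 => braidGen n (j + l) * cableDown n j l

theorem braidGen_comm_cableUp {n a j l : ℕ} (h : a + 1 < j ∨ j + l < a) :
    braidGen n a * cableUp n j l = cableUp n j l * braidGen n a := by
  induction l with
  | zero => simp [cableUp]
  | succ l ih =>
    have h1 : braidGen n a * braidGen n (j + l) = braidGen n (j + l) * braidGen n a := by
      rcases h with h | h
      · exact braidGen_comm (by omega)
      · exact (braidGen_comm (by omega)).symm
    rw [cableUp, ← mul_assoc, ih (by omega), mul_assoc, h1, mul_assoc]

theorem braidGen_comm_cableDown {n a j l : ℕ} (h : a + 1 < j ∨ j + l < a) :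
    braidGen n a * cableDown n j l = cableDown n j l * braidGen n a := by
  induction l with
  | zero => simp [cableDown]
  | succ l ih =>
    have h1 : braidGen n a * braidGen n (j + l) = braidGen n (j + l) * braidGen n a := by
      rcases h with h | h
      · exact braidGen_comm (by omega)
      · exact (braidGen_comm (by omega)).symm
    rw [cableDown, ← mul_assoc, h1, mul_assoc, ih (by omega), mul_assoc]

theorem cable_braid_up {n j l : ℕ} (h : j + l < n - 1) :
    braidGen n j * cableUp n (j + 1) l * cableUp n j l =
      cableUp n (j + 1) l * cableUp n j l * braidGen n (j + l) := by
  induction l with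
  | zero => simp [cableUp]
  | succ l ih =>
    have ih := ih (by omega)
    have c := braidGen_comm_cableUp (n := n) (a := j + l + 1) (j := j) (l := l) (by omega)
    have b := braidGen_braid (n := n) (j := j + l) (by omega)
    rw [cableUp, cableUp, show j + 1 + l = j + l + 1 by omega, show j + (l + 1) = j + l + 1 by omega]
    calc _ = braidGen n j * cableUp n (j + 1) l * (braidGen n (j + l + 1) * cableUp n j l) *
              braidGen n (j + l) := by group
      _ = (braidGen n j * cableUp n (j + 1) l * cableUp n j l) * braidGen n (j + l + 1) *
              braidGen n (j + l) := by rw [c]; group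
      _ = cableUp n (j + 1) l * cableUp n j l *
              (braidGen n (j + l) * braidGen n (j + l + 1) * braidGen n (j + l)) := by
            rw [ih]; group
      _ = cableUp n (j + 1) l * (cableUp n j l * braidGen n (j + l + 1)) *
              braidGen n (j + l) * braidGen n (j + l + 1) := by rw [b]; group
      _ = _ := by rw [← c]; group

theorem cable_braid_mid {n j l : ℕ} (h : j + l < n - 1) :
    cableUp n j l * braidGen n (j + l) * cableDown n j l =
      cableDown n (j + 1) l * braidGen n j * cableUp n (j + 1) l := by
  induction l with
  | zero => simp [cableUp, cableDown]
  | succ l ih =>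
    have ih := ih (by omega)
    have c := braidGen_comm_cableUp (n := n) (a := j + l + 1) (j := j) (l := l) (by omega)
    have c' := braidGen_comm_cableDown (n := n) (a := j + l + 1) (j := j) (l := l) (by omega)
    have b := braidGen_braid (n := n) (j := j + l) (by omega)
    simp only [cableUp, cableDown, show j + 1 + l = j + l + 1 by omega,
      show j + (l + 1) = j + l + 1 by omega]
    calc _ = cableUp n j l *
              (braidGen n (j + l) * braidGen n (j + l + 1) * braidGen n (j + l)) *
              cableDown n j l := by group
      _ = (cableUp n j l * braidGen n (j + l + 1)) * braidGen n (j + l) *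
              (braidGen n (j + l + 1) * cableDown n j l) := by rw [b]; group
      _ = braidGen n (j + l + 1) *
              (cableUp n j l * braidGen n (j + l) * cableDown n j l) *
              braidGen n (j + l + 1) := by rw [← c, c']; group
      _ = _ := by rw [ih]; group

theorem cable_braid_down {n j l : ℕ} (h : j + l < n - 1) :
    cableDown n j l * cableDown n (j + 1) l * braidGen n j =
      braidGen n (j + l) * cableDown n j l * cableDown n (j + 1) l := by
  induction l with
  | zero => simp [cableDown]
  | succ l ih =>
    have ih := ih (by omega)
    have c := braidGen_comm_cableDown (n := n) (a := j + l + 1) (j := j) (l := l) (by omega)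
    have b := braidGen_braid (n := n) (j := j + l) (by omega)
    rw [cableDown, cableDown, show j + 1 + l = j + l + 1 by omega,
      show j + (l + 1) = j + l + 1 by omega]
    calc _ = braidGen n (j + l) * (cableDown n j l * braidGen n (j + l + 1)) *
              cableDown n (j + 1) l * braidGen n j := by group
      _ = braidGen n (j + l) * braidGen n (j + l + 1) *
              (cableDown n j l * cableDown n (j + 1) l * braidGen n j) := by rw [← c]; group
      _ = (braidGen n (j + l) * braidGen n (j + l + 1) * braidGen n (j + l)) *
              cableDown n j l * cableDown n (j + 1) l := by rw [ih]; group
      _ = braidGen n (j + l + 1) * braidGen n (j + l) *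
              (braidGen n (j + l + 1) * cableDown n j l) * cableDown n (j + 1) l := by
            rw [b]; group
      _ = _ := by rw [c]; group

/-- The adjacent transposition `(j, j+1)` of `{0, …, m-1}`, or `1` when out of range. -/
def adjSwap (m j : ℕ) : Equiv.Perm (Fin m) :=
  if h : j + 1 < m then Equiv.swap ⟨j, by omega⟩ ⟨j + 1, h⟩ else 1

/-- The braid on `n = m + l - 1` strands got from the generator `σ_j` on `m` strands by replacing
the strand whose *final* position is `a` by `l` parallel strands. -/
def cableGen (n l j a : ℕ) : BraidGroup n :=
  if a < j then braidGen n (j + l - 1)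
  else if a = j then cableDown n j l
  else if a = j + 1 then cableUp n j l
  else braidGen n j

/-- Pairs of a family `f` (indexed by final positions of the strands) of braids on `n` strands and
a permutation of `m` strands. -/
abbrev CableTarget (m n : ℕ) : Type :=
  (Fin m → BraidGroup n) ⋊[mulAutArrow] Equiv.Perm (Fin m)

theorem adjSwap_val {m j : ℕ} (h : j + 1 < m) (a : Fin m) :
    ((adjSwap m j a : Fin m) : ℕ) =
      if (a : ℕ) = j then j + 1 else if (a : ℕ) = j + 1 then j else a := by
  rw [adjSwap, dif_pos h, Equiv.swap_apply_def]
  simp only [Fin.ext_iff]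
  split_ifs <;> rfl

theorem adjSwap_inv (m j : ℕ) : (adjSwap m j)⁻¹ = adjSwap m j := by
  unfold adjSwap
  split_ifs <;> simp

theorem cable_arrow_apply {m n : ℕ} (τ : Equiv.Perm (Fin m)) (f : Fin m → BraidGroup n)
    (a : Fin m) : mulAutArrow τ f a = f (τ⁻¹ a) := rfl

/-- The image of the generator `σ_j`: its cablings, together with its permutation. -/
def cableGenPair (m l n j : ℕ) : CableTarget m n :=
  ⟨fun a => cableGen n l j a, adjSwap m j⟩

theorem cableGenPair_braid {m l n : ℕ} (h : m + l = n + 1) (j : ℕ) (hj : j + 1 < m - 1) :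
    cableGenPair m l n j * cableGenPair m l n (j + 1) * cableGenPair m l n j =
      cableGenPair m l n (j + 1) * cableGenPair m l n j * cableGenPair m l n (j + 1) := by
  have h1 : j + 1 < m := by omega
  have h2 : j + 1 + 1 < m := by omega
  apply SemidirectProduct.ext
  · funext a
    simp only [SemidirectProduct.mul_left, SemidirectProduct.mul_right, cableGenPair,
      Pi.mul_apply, cable_arrow_apply, mul_inv_rev, adjSwap_inv,
      Equiv.Perm.mul_apply, adjSwap_val h1, adjSwap_val h2, cableGen]
    have e1 : j + 1 + l - 1 = j + l := by omega
    have f1 : ¬ j = j + 1 + 1 := by omega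
    have f2 : ¬ j + 1 + 1 = j := by omega
    have f3 : ¬ j + 1 + 1 < j := by omega
    have f4 : ¬ j + 1 + 1 ≤ j := by omega
    rcases lt_or_ge (a : ℕ) j with ha | ha
    · have := braidGen_braid (n := n) (j := j + l - 1) (by omega)
      rw [show j + l - 1 + 1 = j + l by omega] at this
      simp [show (a : ℕ) ≠ j by omega, show (a : ℕ) ≠ j + 1 by omega, ha,
        show (a : ℕ) ≠ j + 1 + 1 by omega, show (a : ℕ) < j + 1 by omega, e1, this]
    rcases eq_or_ne (a : ℕ) j with ha | ha1
    · have := cable_braid_down (n := n) (j := j) (l := l) (by omega)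
      simp [ha, e1, f1, f2, f3, f4, this]
    rcases eq_or_ne (a : ℕ) (j + 1) with ha | ha2
    · have := cable_braid_mid (n := n) (j := j) (l := l) (by omega)
      simp [ha, e1, f1, f2, f3, f4, this]
    rcases eq_or_ne (a : ℕ) (j + 1 + 1) with ha | ha3
    · have := cable_braid_up (n := n) (j := j) (l := l) (by omega)
      simp [ha, e1, f1, f2, f3, f4, this]
    · have := braidGen_braid (n := n) (j := j) (by omega)
      simp [ha1, ha2, ha3, show ¬ (a : ℕ) < j by omega, show ¬ (a : ℕ) < j + 1 by omega, this]
  · ext a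
    simp only [SemidirectProduct.mul_right, cableGenPair, Equiv.Perm.mul_apply,
      adjSwap_val h1, adjSwap_val h2]
    split_ifs <;> omega

theorem cableGenPair_comm {m l n : ℕ} (h : m + l = n + 1) (i j : ℕ) (hij : i + 1 < j)
    (hj : j < m - 1) :
    cableGenPair m l n i * cableGenPair m l n j =
      cableGenPair m l n j * cableGenPair m l n i := by
  have h1 : i + 1 < m := by omega
  have h2 : j + 1 < m := by omega
  apply SemidirectProduct.ext
  · funext a
    simp only [SemidirectProduct.mul_left, cableGenPair,
      Pi.mul_apply, cable_arrow_apply, adjSwap_inv,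
      adjSwap_val h1, adjSwap_val h2, cableGen]
    rcases lt_or_ge (a : ℕ) i with ha | ha
    · simp [ha, show (a : ℕ) ≠ i by omega, show (a : ℕ) ≠ i + 1 by omega,
        show (a : ℕ) ≠ j by omega, show (a : ℕ) ≠ j + 1 by omega, show (a : ℕ) < j by omega]
      exact braidGen_comm (by omega)
    rcases eq_or_ne (a : ℕ) i with ha | ha1
    · simp [ha, show i ≠ j by omega, show i ≠ j + 1 by omega, show i < j by omega, hij]
      exact (braidGen_comm_cableDown (by omega)).symm
    rcases eq_or_ne (a : ℕ) (i + 1) with ha | ha2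
    · simp [ha, show i + 1 ≠ j by omega, show i ≠ j by omega, show i < j by omega, hij]
      exact (braidGen_comm_cableUp (by omega)).symm
    rcases lt_or_ge (a : ℕ) j with ha3 | ha3
    · simp [ha1, ha2, ha3, show (a : ℕ) ≠ j by omega, show (a : ℕ) ≠ j + 1 by omega,
        show ¬ (a : ℕ) < i by omega]
      exact braidGen_comm (by omega)
    rcases eq_or_ne (a : ℕ) j with ha4 | ha4
    · simp [ha4, show j ≠ i by omega, show j ≠ i + 1 by omega, show ¬ j < i by omega,
        show ¬ j + 1 < i by omega, show j + 1 ≠ i by omega]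
      exact braidGen_comm_cableDown (by omega)
    rcases eq_or_ne (a : ℕ) (j + 1) with ha5 | ha5
    · simp [ha5, show j ≠ i by omega, show j ≠ i + 1 by omega, show ¬ j < i by omega,
        show ¬ j + 1 < i by omega, show j + 1 ≠ i by omega]
      exact braidGen_comm_cableUp (by omega)
    · simp [ha1, ha2, ha4, ha5, show ¬ (a : ℕ) < i by omega, show ¬ (a : ℕ) < j by omega]
      exact braidGen_comm (by omega)
  · ext a
    simp only [SemidirectProduct.mul_right, cableGenPair, Equiv.Perm.mul_apply,
      adjSwap_val h1, adjSwap_val h2]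
    split_ifs <;> omega

/-- The homomorphism recording all cablings of a braid on `m` strands by `l` parallel strands
(indexed by the final position of the cabled strand), together with its permutation. -/
def cableHom {m l n : ℕ} (h : m + l = n + 1) : BraidGroup m →* CableTarget m n :=
  braidLift (cableGenPair m l n) (cableGenPair_braid h) (cableGenPair_comm h)

/-- The homomorphism placing a braid on `l` strands onto the strands `i, …, i + l - 1`. -/
def insertHom {m l n : ℕ} (h : m + l = n + 1) (i : Fin m) : BraidGroup l →* BraidGroup n :=
  braidLift (fun j => braidGen n (i + j))
    (fun j hj => braidGen_braid (by have := i.2; omega))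
    (fun a b hab _ => braidGen_comm (by omega))

/-- The cabling map `γ ∘_i ρ`, on `n = m + l - 1` strands. A product `β β'` of braids performs
`β'` first; strands are named by their initial position. So `ρ` is first performed on the strands
`i, …, i + l - 1`, which are then moved as one thick strand according to `γ`. -/
def cable {m l n : ℕ} (h : m + l = n + 1) (i : Fin m) (γ : BraidGroup m) (ρ : BraidGroup l) :
    BraidGroup n :=
  (cableHom h γ).left ((cableHom h γ).right i) * insertHom h i ρ

/-! ### The Matsumoto section and the shuffle elements -/

theorem exists_adjSwap_word {n : ℕ} (τ : Equiv.Perm (Fin n)) :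
    ∃ w : List (Fin (n - 1)), (w.map fun j => adjSwap n j).prod = τ := by
  match n, τ with
  | 0, τ => exact ⟨[], Subsingleton.elim _ _⟩
  | n + 1, τ =>
    have hτ : τ ∈ (⊤ : Submonoid (Equiv.Perm (Fin (n + 1)))) := trivial
    rw [← Equiv.Perm.mclosure_swap_castSucc_succ] at hτ
    induction hτ using Submonoid.closure_induction with
    | mem x hx =>
      obtain ⟨i, rfl⟩ := hx
      refine ⟨[i], ?_⟩
      simp [adjSwap]
      rfl
    | one => exact ⟨[], rfl⟩
    | mul x y _ _ hx hy =>
      obtain ⟨u, rfl⟩ := hx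
      obtain ⟨v, rfl⟩ := hy
      exact ⟨u ++ v, by simp⟩

/-- `w` is a word of minimal length for `τ` in the adjacent transpositions. -/
def IsReducedWord {n : ℕ} (τ : Equiv.Perm (Fin n)) (w : List (Fin (n - 1))) : Prop :=
  (w.map fun j => adjSwap n j).prod = τ ∧
    ∀ w' : List (Fin (n - 1)), (w'.map fun j => adjSwap n j).prod = τ → w.length ≤ w'.length

theorem exists_isReducedWord {n : ℕ} (τ : Equiv.Perm (Fin n)) : ∃ w, IsReducedWord τ w := by
  obtain ⟨w, hw, hmin⟩ := exists_minimalFor_of_wellFoundedLT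
    (fun w : List (Fin (n - 1)) => (w.map fun j => adjSwap n j).prod = τ) List.length
    (exists_adjSwap_word τ)
  exact ⟨w, hw, fun w' hw' => (le_total _ _).elim id (hmin hw')⟩

/-- The Matsumoto lift of `τ`: the product of the braid generators along a minimal length word
for `τ` (by Matsumoto's theorem, any such word gives the same braid). -/
noncomputable def matsumotoLift {n : ℕ} (τ : Equiv.Perm (Fin n)) : BraidGroup n :=
  ((exists_isReducedWord τ).choose.map fun j => braidGen n j).prod

/-- `τ` is a `(p, n - p)`-unshuffle: its inverse is increasing on the first `p` and on the last
`n - p` elements. -/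
def IsUnshuffle {n : ℕ} (p : ℕ) (τ : Equiv.Perm (Fin n)) : Prop :=
  ∀ i j : Fin n, i < j → ((j : ℕ) < p ∨ p ≤ (i : ℕ)) → τ⁻¹ i < τ⁻¹ j

open Classical in
/-- `𝕊_{p, n - p}`, the sum of the Matsumoto lifts of the `(p, n - p)`-unshuffles. -/
noncomputable def unshuffleSum (k : Type*) [Field k] (n p : ℕ) : MonoidAlgebra k (BraidGroup n) :=
  ∑ τ : Equiv.Perm (Fin n) with IsUnshuffle p τ, MonoidAlgebra.single (matsumotoLift τ) 1

/-- The quantum symmetrizer `𝕊_n`. -/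
noncomputable def symmetrizer (k : Type*) [Field k] (n : ℕ) : MonoidAlgebra k (BraidGroup n) :=
  ∑ τ : Equiv.Perm (Fin n), MonoidAlgebra.single (matsumotoLift τ) 1

/-! ### Pro-objects

A pro-object is a functor from a cofiltered category; the index categories needed here are
codirected preorders. -/

section ProObjects

universe u v w

variable {A : Type u} [Ring A] {J : Type v} [Preorder J]

/-- A pro-object is zero iff its identity is zero in `lim_j colim_i Hom(V_i, V_j)`, that is, iff
each `V_j` receives the zero map from some `V_i`. -/
def IsProZero [IsCofiltered J] (V : J ⥤ ModuleCat.{w} A) : Prop :=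
  ∀ j, ∃ (i : J) (f : i ⟶ j), V.map f = 0

/-- The elements of the limit of an inverse system. -/
abbrev ProLimit (V : J ⥤ ModuleCat.{w} A) : Type _ := (V ⋙ forget (ModuleCat.{w} A)).sections

/-- The term at `j` of an element of the limit. -/
abbrev ProLimit.term {V : J ⥤ ModuleCat.{w} A} (v : ProLimit V) (j : J) : V.obj j := v.1 j

/-- An element `v` of the limit of the system `V` whose image `v_h` generates the `A`-module `V_h`
for all `h` in a cofinal subsystem. -/
def IsProGenerator [IsCofiltered J] (V : J ⥤ ModuleCat.{w} A) (v : ProLimit V) :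
    Prop :=
  ∃ H : Set J, (∀ j, ∃ h ∈ H, h ≤ j) ∧
    ∀ h ∈ H, Submodule.span A {v.term h} = ⊤

/-- The system `V` is pro-cyclic. -/
def IsProCyclic [IsCofiltered J] (V : J ⥤ ModuleCat.{w} A) : Prop :=
  ∃ v : ProLimit V, IsProGenerator V v

end ProObjects

/-! ### Finite quotients of braid groups -/

/-- The finite quotients of the braid group, given by their kernels. Smaller kernels are larger
quotients, and there is a map from the quotient by `N` to that by `M` when `N ≤ M`. -/
abbrev BraidQuot (n : ℕ) : Type := FiniteIndexNormalSubgroup (BraidGroup n)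

instance (n : ℕ) : Nonempty (BraidQuot n) := ⟨.ofSubgroup ⊤⟩

section Quotients

variable (k : Type*) [Field k] {n : ℕ}

/-- The group algebra of a finite quotient of the braid group; these form the profinite completion
of the braided associative operad. -/
abbrev QuotAlg (N : BraidQuot n) : Type _ := MonoidAlgebra k (BraidGroup n ⧸ N.toSubgroup)

/-- Right modules over the group algebra of the braid group are modules over this ring. -/
abbrev BraidAlgOp (n : ℕ) : Type _ := (MonoidAlgebra k (BraidGroup n))ᵐᵒᵖ

/-- The projection from the group algebra of the braid group. -/
noncomputable def toQuotAlg (N : BraidQuot n) : MonoidAlgebra k (BraidGroup n) →+* QuotAlg k N :=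
  MonoidAlgebra.mapDomainRingHom k (QuotientGroup.mk' N.toSubgroup)

/-- The right action of the braid group on the group algebra of a finite quotient. -/
noncomputable instance (N : BraidQuot n) : Module (BraidAlgOp k n) (QuotAlg k N) :=
  Module.compHom (QuotAlg k N) (toQuotAlg k N).op

theorem quotAlg_smul_def {N : BraidQuot n} (a : BraidAlgOp k n) (x : QuotAlg k N) :
    a • x = x * toQuotAlg k N a.unop := rfl

/-- The transition map between two finite quotients. -/
def quotMap {N M : BraidQuot n} (h : N ≤ M) :
    BraidGroup n ⧸ N.toSubgroup →* BraidGroup n ⧸ M.toSubgroup :=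
  QuotientGroup.map N.toSubgroup M.toSubgroup (MonoidHom.id _) fun _ hx => h hx

/-- The transition map between the group algebras of two finite quotients. -/
noncomputable def transRingHom {N M : BraidQuot n} (h : N ≤ M) : QuotAlg k N →+* QuotAlg k M :=
  MonoidAlgebra.mapDomainRingHom k (quotMap h)

theorem transRingHom_toQuotAlg {N M : BraidQuot n} (h : N ≤ M) (a : MonoidAlgebra k (BraidGroup n)) :
    transRingHom k h (toQuotAlg k N a) = toQuotAlg k M a := by
  have : (transRingHom k h).comp (toQuotAlg k N) = toQuotAlg k M := by
    rw [transRingHom, toQuotAlg, ← MonoidAlgebra.mapDomainRingHom_comp]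
    rfl
  exact congrArg (fun f => f a) this

/-- The transition map as a map of right modules over the group algebra of the braid group. -/
noncomputable def transHom {N M : BraidQuot n} (h : N ≤ M) :
    QuotAlg k N →ₗ[BraidAlgOp k n] QuotAlg k M where
  toFun := transRingHom k h
  map_add' := map_add _
  map_smul' a x := by
    simp only [quotAlg_smul_def, map_mul, transRingHom_toQuotAlg, RingHom.id_apply]

theorem transHom_refl {N : BraidQuot n} (x : QuotAlg k N) : transHom k (le_refl N) x = x := by
  have : transRingHom k (le_refl N) = RingHom.id _ := by
    rw [transRingHom, show quotMap (le_refl N) = MonoidHom.id _ from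
      QuotientGroup.monoidHom_ext _ rfl, MonoidAlgebra.mapDomainRingHom_id]
  exact congrArg (fun f => f x) this

theorem transHom_trans {N M L : BraidQuot n} (h : N ≤ M) (h' : M ≤ L) (x : QuotAlg k N) :
    transHom k h' (transHom k h x) = transHom k (h.trans h') x := by
  have : (transRingHom k h').comp (transRingHom k h) = transRingHom k (h.trans h') := by
    rw [transRingHom, transRingHom, transRingHom, ← MonoidAlgebra.mapDomainRingHom_comp,
      show (quotMap h').comp (quotMap h) = quotMap (h.trans h') from
        QuotientGroup.monoidHom_ext _ rfl]
  exact congrArg (fun f => f x) this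

/-- Left multiplication by an element of the group algebra of the braid group. -/
noncomputable def leftMul (N : BraidQuot n) (f : MonoidAlgebra k (BraidGroup n)) :
    QuotAlg k N →ₗ[BraidAlgOp k n] QuotAlg k N where
  toFun x := toQuotAlg k N f * x
  map_add' := mul_add _
  map_smul' a x := by simp only [quotAlg_smul_def, mul_assoc, RingHom.id_apply]

theorem transHom_leftMul {N M : BraidQuot n} (h : N ≤ M) (f : MonoidAlgebra k (BraidGroup n))
    (x : QuotAlg k N) : transHom k h (leftMul k N f x) = leftMul k M f (transHom k h x) := by
  change transRingHom k h (toQuotAlg k N f * x) = toQuotAlg k M f * transRingHom k h x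
  rw [map_mul, transRingHom_toQuotAlg]

end Quotients

/-! ### Braided subsequences of the profinite braided associative operad -/

/-- A braided subsequence of the profinite braided associative operad: for each finite quotient of
each braid group a right submodule of its group algebra, compatibly with the transition maps. -/
structure BraidedSubseq (k : Type*) [Field k] where
  obj : ∀ {n : ℕ} (N : BraidQuot n), Submodule (BraidAlgOp k n) (QuotAlg k N)
  map_mem : ∀ {n : ℕ} {N M : BraidQuot n} (h : N ≤ M) (x : QuotAlg k N),
    x ∈ obj N → transHom k h x ∈ obj M

namespace BraidedSubseq

variable {k : Type*} [Field k]

/-- The arity `n` part of a braided subsequence, as an inverse system of right modules over the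
group algebra of the braid group. -/
noncomputable def pro (C : BraidedSubseq k) (n : ℕ) : BraidQuot n ⥤ ModuleCat (BraidAlgOp k n) where
  obj N := ModuleCat.of _ (C.obj N)
  map f := ModuleCat.ofHom ((transHom k f.le).restrict (C.map_mem f.le))
  map_id N := by
    refine ModuleCat.hom_ext (LinearMap.ext fun x => Subtype.ext ?_)
    exact transHom_refl k x.1
  map_comp f g := by
    refine ModuleCat.hom_ext (LinearMap.ext fun x => Subtype.ext ?_)
    exact (transHom_trans k f.le g.le x.1).symm

variable (k)

/-- The braided primitive operad: zero in arities `0` and `1`, and in arity `n > 1` the common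
kernel of left multiplication by `𝕊_{p, q}` for `p + q = n`, `p, q > 0`. -/
noncomputable def brPrim : BraidedSubseq k where
  obj {n} N := if n ≤ 1 then ⊥ else
    ⨅ (p : ℕ) (_ : 0 < p ∧ p < n), LinearMap.ker (leftMul k N (unshuffleSum k n p))
  map_mem {n N M} h x hx := by
    split_ifs at hx ⊢ with hn
    · rw [Submodule.mem_bot] at hx ⊢
      rw [hx, map_zero]
    · simp only [Submodule.mem_iInf, LinearMap.mem_ker] at hx ⊢
      intro p hp
      rw [← transHom_leftMul, hx p hp, map_zero]

/-- The Woronowicz ideal: the kernel of left multiplication by the quantum symmetrizer. -/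
noncomputable def woronowicz : BraidedSubseq k where
  obj {n} N := LinearMap.ker (leftMul k N (symmetrizer k n))
  map_mem {n N M} h x hx := by
    rw [LinearMap.mem_ker] at hx ⊢
    rw [← transHom_leftMul, hx, map_zero]

/-- The part of the profinite braided associative operad in arities greater than `1`. -/
noncomputable def brAssGtOne : BraidedSubseq k where
  obj {n} _ := if 1 < n then ⊤ else ⊥
  map_mem {n N M} h x hx := by
    split_ifs at hx ⊢ with hn
    · trivial
    · rw [Submodule.mem_bot] at hx ⊢
      rw [hx, map_zero]

end BraidedSubseq

/-! ### Operadic composition and indecomposables -/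

/-- The condition that the cabling map `∘_i` descends to a map from the finite quotients given by
`P` and `Q` to that given by `R`. -/
def Admissible {m l n : ℕ} (h : m + l = n + 1) (i : Fin m) (P : BraidQuot m) (Q : BraidQuot l)
    (R : BraidQuot n) : Prop :=
  ∀ γ γ' ρ ρ', γ⁻¹ * γ' ∈ P → ρ⁻¹ * ρ' ∈ Q → (cable h i γ ρ)⁻¹ * cable h i γ' ρ' ∈ R

section Composition

variable {m l n : ℕ} {h : m + l = n + 1} {i : Fin m} {P : BraidQuot m} {Q : BraidQuot l} {R : BraidQuot n}

/-- The cabling map between finite quotients. -/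
def cableQuot (hA : Admissible h i P Q R) :
    BraidGroup m ⧸ P.toSubgroup → BraidGroup l ⧸ Q.toSubgroup → BraidGroup n ⧸ R.toSubgroup :=
  Quotient.map₂ (cable h i) fun γ γ' hγ ρ ρ' hρ =>
    QuotientGroup.leftRel_apply.2
      (hA γ γ' ρ ρ' (QuotientGroup.leftRel_apply.1 hγ) (QuotientGroup.leftRel_apply.1 hρ))

/-- The operadic composition `α ∘_i β` at the level of finite quotients: the bilinear extension
of the cabling map. -/
noncomputable def circ {k : Type*} [Field k] (hA : Admissible h i P Q R) (α : QuotAlg k P)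
    (β : QuotAlg k Q) : QuotAlg k R :=
  α.coeff.sum fun x a => β.coeff.sum fun y b => MonoidAlgebra.single (cableQuot hA x y) (a * b)

theorem Admissible.mono {P' : BraidQuot m} {Q' : BraidQuot l} (hA : Admissible h i P Q R) (hP : P' ≤ P)
    (hQ : Q' ≤ Q) : Admissible h i P' Q' R :=
  fun γ γ' ρ ρ' hγ hρ => hA γ γ' ρ ρ' (hP hγ) (hQ hρ)

/-- Sufficiently large finite quotients are admissible. -/
theorem exists_admissible (h : m + l = n + 1) (R : BraidQuot n) :
    ∃ (P : BraidQuot m) (Q : BraidQuot l), ∀ i, Admissible h i P Q R := by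
  let π := QuotientGroup.mk' R.toSubgroup
  let πF : (Fin m → BraidGroup n) →* (Fin m → BraidGroup n ⧸ R.toSubgroup) := π.compLeft (Fin m)
  let Ψ : CableTarget m n →*
      (Fin m → BraidGroup n ⧸ R.toSubgroup) ⋊[mulAutArrow] Equiv.Perm (Fin m) :=
    SemidirectProduct.map πF (MonoidHom.id _) (fun τ => by ext f a; rfl)
  let Φ := Ψ.comp (cableHom h)
  have : Finite ((Fin m → BraidGroup n ⧸ R.toSubgroup) ⋊[mulAutArrow] Equiv.Perm (Fin m)) :=
    Finite.of_equiv _ SemidirectProduct.equivProd.symm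
  let Θ : BraidGroup l →* (Fin m → BraidGroup n ⧸ R.toSubgroup) :=
    MonoidHom.pi fun i => π.comp (insertHom h i)
  refine ⟨.ofSubgroup Φ.ker, .ofSubgroup Θ.ker, fun i γ γ' ρ ρ' hγ hρ => ?_⟩
  have hγ : Φ γ = Φ γ' := by
    have : Φ (γ⁻¹ * γ') = 1 := hγ
    rwa [map_mul, map_inv, inv_mul_eq_one] at this
  have hρ : Θ ρ = Θ ρ' := by
    have : Θ (ρ⁻¹ * ρ') = 1 := hρ
    rwa [map_mul, map_inv, inv_mul_eq_one] at this
  have e1 : (cableHom h γ).right = (cableHom h γ').right :=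
    show (Φ γ).right = (Φ γ').right by rw [hγ]
  have e2 : ∀ a, π ((cableHom h γ).left a) = π ((cableHom h γ').left a) :=
    fun a => show (Φ γ).left a = (Φ γ').left a by rw [hγ]
  have e3 : π (insertHom h i ρ) = π (insertHom h i ρ') := congrFun hρ i
  refine QuotientGroup.eq.1 (show π (cable h i γ ρ) = π (cable h i γ' ρ') from ?_)
  rw [cable, cable, map_mul, map_mul, e1, e2, e3]

end Composition

/-- Families of finite quotients, one for each braid group, through which all the composition maps
`∘_i` into arity `n` from arities `m` and `l` smaller than `n` are defined. -/
def IndexFamily (n : ℕ) : Type :=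
  {P : (j : ℕ) → BraidQuot j // ∀ (m l : ℕ) (h : m + l = n + 1), 2 ≤ m → 2 ≤ l →
    ∀ i, Admissible h i (P m) (P l) (P n)}

instance (n : ℕ) : PartialOrder (IndexFamily n) :=
  inferInstanceAs (PartialOrder {P : (j : ℕ) → BraidQuot j // _})

/-- Any family of finite quotients is dominated by one in `IndexFamily n`. -/
theorem exists_indexFamily_le {n : ℕ} (P : (j : ℕ) → BraidQuot j) :
    ∃ P' : IndexFamily n, (∀ j, P'.1 j ≤ P j) ∧ P'.1 n = P n := by
  choose F G hFG using fun (m l : ℕ) (h : m + l = n + 1) => exists_admissible h (P n)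
  have hA : ∀ m, ∃ A : BraidQuot m, ∀ l h, A ≤ F m l h := by
    intro m
    by_cases hm : ∃ l, m + l = n + 1
    · obtain ⟨l, h⟩ := hm
      refine ⟨F m l h, fun l' h' => ?_⟩
      obtain rfl : l = l' := by omega
      exact le_rfl
    · exact ⟨P m, fun l h => (hm ⟨l, h⟩).elim⟩
  have hB : ∀ l, ∃ B : BraidQuot l, ∀ m h, B ≤ G m l h := by
    intro l
    by_cases hl : ∃ m, m + l = n + 1
    · obtain ⟨m, h⟩ := hl
      refine ⟨G m l h, fun m' h' => ?_⟩
      obtain rfl : m = m' := by omega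
      exact le_rfl
    · exact ⟨P l, fun m h => (hl ⟨m, h⟩).elim⟩
  choose A hA using hA
  choose B hB using hB
  refine ⟨⟨fun j => if j = n then P j else P j ⊓ A j ⊓ B j, ?_⟩, ?_, ?_⟩
  · intro m l h hm hl i
    simp only [if_pos, if_neg (show m ≠ n by omega), if_neg (show l ≠ n by omega)]
    exact (hFG m l h i).mono ((inf_le_left.trans inf_le_right).trans (hA m l h))
      (inf_le_right.trans (hB l m h))
  · intro j
    dsimp only
    split_ifs
    · exact le_rfl
    · exact inf_le_left.trans inf_le_left
  · simp

instance (n : ℕ) : Nonempty (IndexFamily n) :=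
  ⟨(exists_indexFamily_le fun _ => .ofSubgroup ⊤).choose⟩

instance (n : ℕ) : IsCodirectedOrder (IndexFamily n) :=
  ⟨fun P P' => by
    obtain ⟨P'', h, -⟩ := exists_indexFamily_le (n := n) fun j => P.1 j ⊓ P'.1 j
    exact ⟨P'', fun j => (h j).trans inf_le_left, fun j => (h j).trans inf_le_right⟩⟩

theorem transRingHom_single {k : Type*} [Field k] {n : ℕ} {N M : BraidQuot n} (h : N ≤ M)
    (x : BraidGroup n ⧸ N.toSubgroup) (a : k) :
    transRingHom k h (MonoidAlgebra.single x a) = MonoidAlgebra.single (quotMap h x) a := by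
  simp [transRingHom]

theorem transHom_circ {k : Type*} [Field k] {m l n : ℕ} {h : m + l = n + 1} {i : Fin m}
    {P P' : BraidQuot m} {Q Q' : BraidQuot l} {R R' : BraidQuot n} (hA : Admissible h i P Q R)
    (hA' : Admissible h i P' Q' R') (hP : P ≤ P') (hQ : Q ≤ Q') (hR : R ≤ R') (α : QuotAlg k P)
    (β : QuotAlg k Q) :
    transHom k hR (circ hA α β) = circ hA' (transHom k hP α) (transHom k hQ β) := by
  have key : ∀ x y, quotMap hR (cableQuot hA x y) = cableQuot hA' (quotMap hP x) (quotMap hQ y) := by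
    rintro ⟨x⟩ ⟨y⟩
    rfl
  have e1 : (transHom k hP α).coeff = α.coeff.mapDomain (quotMap hP) := rfl
  have e2 : (transHom k hQ β).coeff = β.coeff.mapDomain (quotMap hQ) := rfl
  rw [circ, circ, e1, e2, Finsupp.sum_mapDomain_index (by simp) (by
    intro b a a'
    simp [add_mul, Finsupp.sum_add])]
  change transRingHom k hR _ = _
  rw [Finsupp.sum, Finsupp.sum, map_sum]
  refine Finset.sum_congr rfl fun x _ => ?_
  rw [Finsupp.sum_mapDomain_index (by simp) (by intro b a a'; simp [mul_add])]
  rw [Finsupp.sum, Finsupp.sum, map_sum]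
  refine Finset.sum_congr rfl fun y _ => ?_
  rw [transRingHom_single, key]

section Indecomposables

variable {k : Type*} [Field k] (C M : BraidedSubseq k) {n : ℕ}

/-- The image in the group algebra of a finite quotient of the sum of the composition maps
`∘_i : Ind (C(m) ⊗ M(l)) → M(n)`, over `2 ≤ m ≤ n - 1`, `l = n - m + 1` and all `i`: the right
submodule generated by all compositions. -/
noncomputable def decomposables (P : IndexFamily n) :
    Submodule (BraidAlgOp k n) (QuotAlg k (P.1 n)) :=
  Submodule.span _ {x | ∃ (m l : ℕ) (h : m + l = n + 1) (hm : 2 ≤ m) (hl : 2 ≤ l) (i : Fin m),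
    ∃ α ∈ C.obj (P.1 m), ∃ β ∈ M.obj (P.1 l), x = circ (P.2 m l h hm hl i) α β}

/-- The value of the indecomposables at one index. -/
abbrev IndecObj (P : IndexFamily n) : Type _ :=
  M.obj (P.1 n) ⧸ (decomposables C M P).submoduleOf (M.obj (P.1 n))

theorem decomposables_map_mem {P P' : IndexFamily n} (h : P ≤ P') (x : QuotAlg k (P.1 n))
    (hx : x ∈ decomposables C M P) : transHom k (h n) x ∈ decomposables C M P' := by
  have : decomposables C M P ≤ (decomposables C M P').comap (transHom k (h n)) := by
    refine Submodule.span_le.2 ?_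
    rintro _ ⟨m, l, e, hm, hl, i, α, hα, β, hβ, rfl⟩
    exact Submodule.subset_span ⟨m, l, e, hm, hl, i, transHom k (h m) α, C.map_mem _ _ hα,
      transHom k (h l) β, M.map_mem _ _ hβ, transHom_circ _ _ _ _ _ _ _⟩
  exact this hx

/-- The indecomposables of `M` over `C` in arity `n`: the cokernel, as a pro-object, of the sum of
the composition maps `∘_i : Ind (C(m) ⊗ M(n-m+1)) → M(n)`. As the composition maps into the term
of `M(n)` at a finite quotient are defined on the terms of `C(m)` and `M(n-m+1)` at sufficiently
large finite quotients, the cokernel is indexed by the families in `IndexFamily n`. -/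
noncomputable def indec (n : ℕ) : IndexFamily n ⥤ ModuleCat (BraidAlgOp k n) where
  obj P := ModuleCat.of _ (IndecObj C M P)
  map {P P'} f := ModuleCat.ofHom (Submodule.mapQ _ _
    ((transHom k (f.le n)).restrict (M.map_mem (f.le n)))
    (fun x hx => decomposables_map_mem C M f.le x.1 hx))
  map_id P := by
    refine ModuleCat.hom_ext (LinearMap.ext fun x => ?_)
    obtain ⟨x, rfl⟩ := Submodule.mkQ_surjective _ x
    exact congrArg (Submodule.mkQ _) (Subtype.ext (transHom_refl k x.1))
  map_comp f g := by
    refine ModuleCat.hom_ext (LinearMap.ext fun x => ?_)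
    obtain ⟨x, rfl⟩ := Submodule.mkQ_surjective _ x
    exact congrArg (Submodule.mkQ _) (Subtype.ext (transHom_trans k (f.le n) (g.le n) x.1).symm)

/-- The map from the limit of `M(n)` to the limit of its indecomposables. -/
noncomputable def toIndec (v : ProLimit (M.pro n)) :
    ProLimit (indec C M n) :=
  ⟨fun P => (decomposables C M P).submoduleOf (M.obj (P.1 n)) |>.mkQ (v.term (P.1 n)), by
    intro P P' f
    exact congrArg (Submodule.mkQ _) (v.2 (homOfLE (f.le n)))⟩

end Indecomposables

/-- `e` is an idempotent that generates the right ideal `I` and is fixed by the antipode `g ↦ g⁻¹`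
of the group algebra. -/
def IsSymmIdempotentOf {k : Type*} [Field k] {n : ℕ} {N : BraidQuot n}
    (I : Submodule (BraidAlgOp k n) (QuotAlg k N)) (e : QuotAlg k N) : Prop :=
  e * e = e ∧ HopfAlgebra.antipode k e = e ∧ (I : Set (QuotAlg k N)) = {x | ∃ y, x = e * y}

/-- `g` is the element of the limit of `M(n)` whose term at each finite quotient is the unique
antipode-fixed idempotent that generates the right ideal given by `M(n)`. For the braided primitive
operad this is the braided Garsia idempotent. -/
def IsGarsiaElement {k : Type*} [Field k] (M : BraidedSubseq k) {n : ℕ}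
    (g : ProLimit (M.pro n)) : Prop :=
  ∀ (N : BraidQuot n) (e : QuotAlg k N),
    IsSymmIdempotentOf (M.obj N) e ↔ e = (show M.obj N from g.term N).1

/-! Fix a finite quotient of the braid group and let `S` be the antipode of its group algebra. The
coefficient at `1` of `S a * b` is the standard dot product of `a` and `b`, which is positive
definite over `ℚ`, and left multiplications by `x` and by `S x` are adjoint for it. Hence the
orthogonal projection onto a common kernel of left multiplications is itself left multiplication by
an antipode-fixed idempotent `e`, and `1 - e` lies in the left ideal generated by the defining
elements (`exists_isKernelIdempotent_rat`). The shuffle elements are rational, so `e` can be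
transported to every field of characteristic `0`. Uniqueness of `e` makes these idempotents
compatible, and `e * v = v` on the kernel makes them generators. Only nonvanishing remains.

For this, let `χ` be the character sending every braid generator to a primitive `n`-th root of unity
`ζ`. A Matsumoto lift goes to `ζ ^ inv`, so `𝕊_n` goes to a `q`-factorial and `𝕊_{p, n - p}` to a
`q`-binomial coefficient (`invSum_succ`, `invSum_add`) at `q = ζ`. In arity `n` these vanish for `0
< p < n`, so `χ (1 - e) = 0` and `χ e = 1`. In an arity `l < n`, with the same `ζ`, they are
nonzero, so `χ` kills the kernels there. The character of a cabled braid is a factor depending on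
the outer braid times the character of the inner one, so `χ` kills every composition whose inner
factor lies in such a kernel (`quotChar_circ_eq_zero`). Thus `e` is not decomposable.
`BraidedSubseq.IsRatKernel.main` assembles this for both parts of the theorem. -/

/-! ### Symmetric idempotents for common kernels in group algebras -/

section KernelIdempotent

variable {k : Type*} [Field k] {G : Type*} [Group G] {ι : Type*}

theorem antipode_single_self (g : G) (a : k) :
    HopfAlgebra.antipode k (MonoidAlgebra.single g a) = MonoidAlgebra.single g⁻¹ a := by
  simp [MonoidAlgebra.antipode_single]

theorem monoidAlgebra_antipode_antipode (a : MonoidAlgebra k G) :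
    HopfAlgebra.antipode k (HopfAlgebra.antipode k a) = a := by
  induction a using MonoidAlgebra.induction_linear with
  | zero => simp
  | add x y hx hy => rw [map_add, map_add, hx, hy]
  | single g r => rw [antipode_single_self, antipode_single_self, inv_inv]

theorem monoidAlgebra_antipode_mul (a b : MonoidAlgebra k G) :
    HopfAlgebra.antipode k (a * b) = HopfAlgebra.antipode k b * HopfAlgebra.antipode k a := by
  induction a using MonoidAlgebra.induction_linear with
  | zero => simp
  | add x y hx hy => rw [add_mul, map_add, map_add, mul_add, hx, hy]
  | single g r =>
    induction b using MonoidAlgebra.induction_linear with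
    | zero => simp
    | add x y hx hy => rw [mul_add, map_add, map_add, add_mul, hx, hy]
    | single h s =>
      simp only [antipode_single_self, MonoidAlgebra.single_mul_single, mul_inv_rev, mul_comm]

theorem coeff_antipode (a : MonoidAlgebra k G) (g : G) :
    (HopfAlgebra.antipode k a).coeff g = a.coeff g⁻¹ := by
  classical
  induction a using MonoidAlgebra.induction_linear with
  | zero => simp
  | add x y hx hy => simp [hx, hy]
  | single h r =>
    rw [antipode_single_self, MonoidAlgebra.coeff_single, MonoidAlgebra.coeff_single,
      Finsupp.single_apply, Finsupp.single_apply]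
    simp [inv_eq_iff_eq_inv]

/-- `e` is an idempotent, fixed by the antipode, that generates the common right annihilator of the
elements `x i` for `i ∈ s`. -/
structure IsKernelIdempotent (s : Finset ι) (x : ι → MonoidAlgebra k G) (e : MonoidAlgebra k G) :
    Prop where
  antipode_eq : HopfAlgebra.antipode k e = e
  mul_self : e * e = e
  mul_eq_zero : ∀ i ∈ s, x i * e = 0
  one_sub : ∃ a : ι → MonoidAlgebra k G, 1 - e = ∑ i ∈ s, a i * x i

/-- Since `1 - e` lies in the left ideal generated by the `x i`, it kills whatever they all kill. -/
theorem IsKernelIdempotent.mul_eq_self {s : Finset ι} {x : ι → MonoidAlgebra k G}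
    {e v : MonoidAlgebra k G} (he : IsKernelIdempotent s x e) (hv : ∀ i ∈ s, x i * v = 0) :
    e * v = v := by
  obtain ⟨a, ha⟩ := he.one_sub
  have : (1 - e) * v = 0 := by
    rw [ha, Finset.sum_mul]
    exact Finset.sum_eq_zero fun i hi => by rw [mul_assoc, hv i hi, mul_zero]
  rw [sub_mul, one_mul, sub_eq_zero] at this
  exact this.symm

/-- Kernel idempotents are preserved by ring homomorphisms that commute with the antipodes. -/
theorem IsKernelIdempotent.map {l H : Type*} [Field l] [Group H] {s : Finset ι}
    {x : ι → MonoidAlgebra k G} {e : MonoidAlgebra k G} (he : IsKernelIdempotent s x e)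
    (f : MonoidAlgebra k G →+* MonoidAlgebra l H)
    (hf : ∀ a, HopfAlgebra.antipode l (f a) = f (HopfAlgebra.antipode k a)) :
    IsKernelIdempotent s (fun i => f (x i)) (f e) where
  antipode_eq := by rw [hf, he.antipode_eq]
  mul_self := by rw [← map_mul, he.mul_self]
  mul_eq_zero i hi := by rw [← map_mul, he.mul_eq_zero i hi, map_zero]
  one_sub := by
    obtain ⟨a, ha⟩ := he.one_sub
    refine ⟨fun i => f (a i), ?_⟩
    simpa only [map_sub, map_one, map_sum, map_mul] using congrArg f ha

/-- The source of positivity: over an ordered field a sum of squares vanishes only if every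
coefficient does. -/
theorem coeff_antipode_mul_self_one [Fintype G] (a : MonoidAlgebra k G) :
    (HopfAlgebra.antipode k a * a).coeff 1 = ∑ g, a.coeff g ^ 2 := by
  rw [MonoidAlgebra.coeff_mul_apply_right, Finsupp.sum_fintype _ _ (by simp)]
  refine Finset.sum_congr rfl fun g _ => ?_
  rw [coeff_antipode, one_mul, inv_inv, sq]

/-- The common kernel equals the kernel of left multiplication by the self-adjoint element `y = ∑ S
(x i) * x i`, whose kernel and range are complementary. The kernel component of `1` is the
idempotent. -/
theorem exists_isKernelIdempotent_rat [Finite G] (s : Finset ι) (x : ι → MonoidAlgebra ℚ G) :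
    ∃ e, IsKernelIdempotent s x e := by
  classical
  have := Fintype.ofFinite G
  let S := HopfAlgebra.antipode ℚ (A := MonoidAlgebra ℚ G)
  have pos : ∀ a : MonoidAlgebra ℚ G, 0 ≤ (S a * a).coeff 1 := fun a => by
    rw [coeff_antipode_mul_self_one]
    exact Finset.sum_nonneg fun g _ => sq_nonneg _
  have pos' : ∀ a : MonoidAlgebra ℚ G, (S a * a).coeff 1 = 0 → a = 0 := fun a ha => by
    rw [coeff_antipode_mul_self_one, Finset.sum_eq_zero_iff_of_nonneg fun g _ => sq_nonneg _] at ha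
    ext g
    simpa using ha g (Finset.mem_univ g)
  let y := ∑ i ∈ s, S (x i) * x i
  have hSS : ∀ a, S (S a) = a := monoidAlgebra_antipode_antipode
  have hmul : ∀ a b, S (a * b) = S b * S a := monoidAlgebra_antipode_mul
  have hSy : S y = y := by
    simp only [y, map_sum, hmul, hSS]
  -- The Gram argument: pairing `y * v` with `v` gives the sum of the squared norms of the `x i *
  -- v`.
  have hy : ∀ v, y * v = 0 → ∀ i ∈ s, x i * v = 0 := by
    intro v hv
    have h0 : ∑ i ∈ s, (S (x i * v) * (x i * v)).coeff 1 = 0 := by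
      have : S v * (y * v) = ∑ i ∈ s, S (x i * v) * (x i * v) := by
        simp only [y, Finset.sum_mul, Finset.mul_sum, hmul, mul_assoc]
      rw [hv, mul_zero] at this
      have := congrArg (fun a : MonoidAlgebra ℚ G => a.coeff 1) this.symm
      simpa [MonoidAlgebra.coeff_sum] using this
    rw [Finset.sum_eq_zero_iff_of_nonneg fun i _ => pos _] at h0
    exact fun i hi => pos' _ (h0 i hi)
  let L := LinearMap.mulLeft ℚ y
  -- If `y * (y * w) = 0`, then `y * w` has squared norm zero, because `S (y * w) = S w * y`.
  have hdis : Disjoint (LinearMap.ker L) (LinearMap.range L) := by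
    rw [Submodule.disjoint_def]
    rintro _ hv ⟨w, rfl⟩
    simp only [L, LinearMap.mem_ker, LinearMap.mulLeft_apply] at hv ⊢
    apply pos'
    rw [hmul, hSy, mul_assoc, hv, mul_zero]
    rfl
  have hfin : FiniteDimensional ℚ (MonoidAlgebra ℚ G) :=
    Module.Finite.equiv (MonoidAlgebra.coeffLinearEquiv ℚ).symm
  have htop : LinearMap.ker L ⊔ LinearMap.range L = ⊤ := by
    apply Submodule.eq_top_of_disjoint _ _ _ hdis
    rw [add_comm, LinearMap.finrank_range_add_finrank_ker]
  obtain ⟨e, he, f, ⟨u, rfl⟩, hef⟩ := Submodule.mem_sup.1 (htop ▸ Submodule.mem_top (x := 1))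
  simp only [L, LinearMap.mem_ker, LinearMap.mulLeft_apply] at he hef
  have hey : S e * y = 0 := by
    have := congrArg S he
    rwa [hmul, hSy, map_zero] at this
  -- The right side is fixed by `S`, so `S e` is too, whence `S e = e`; the same identity then says
  -- that `e` is idempotent.
  have h1 : S e = S e * e := by
    calc S e = S e * (e + y * u) := by rw [hef, mul_one]
      _ = _ := by rw [mul_add, ← mul_assoc (S e) y, hey, zero_mul, add_zero]
  have h2 : S e = e := by
    have := congrArg S h1
    rw [hmul, hSS, ← h1] at this
    exact this.symm
  refine ⟨e, h2, by rw [h2] at h1; exact h1.symm, hy e he, fun i => S u * S (x i), ?_⟩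
  -- This puts `1 - e` in a right ideal; applying `S`, which fixes both `1 - e` and `y`, moves it to
  -- the left ideal, as `S u * y`.
  have h3 : 1 - e = y * u := by rw [← hef, add_sub_cancel_left]
  have h4 : S (1 - e) = 1 - e := by
    rw [map_sub, h2, MonoidAlgebra.one_def]
    congr 1
    exact (antipode_single_self 1 1).trans (by rw [inv_one])
  rw [← h4, h3, hmul, hSy]
  simp only [y, Finset.mul_sum, mul_assoc]

theorem antipode_mapRingHom {l : Type*} [Field l] (f : k →+* l) (a : MonoidAlgebra k G) :
    HopfAlgebra.antipode l (MonoidAlgebra.mapRingHom G f a) =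
      MonoidAlgebra.mapRingHom G f (HopfAlgebra.antipode k a) := by
  induction a using MonoidAlgebra.induction_linear with
  | zero => simp
  | add x y hx hy => simp only [map_add, hx, hy]
  | single g r => simp only [antipode_single_self, MonoidAlgebra.mapRingHom_single]

theorem antipode_mapDomainRingHom {H : Type*} [Group H] (f : G →* H) (a : MonoidAlgebra k G) :
    HopfAlgebra.antipode k (MonoidAlgebra.mapDomainRingHom k f a) =
      MonoidAlgebra.mapDomainRingHom k f (HopfAlgebra.antipode k a) := by
  induction a using MonoidAlgebra.induction_linear with
  | zero => simp
  | add x y hx hy => simp only [map_add, hx, hy]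
  | single g r =>
    simp only [antipode_single_self, MonoidAlgebra.mapDomainRingHom_apply,
      MonoidAlgebra.mapDomain_single, map_inv]

end KernelIdempotent

/-! ### Garsia elements of the inverse systems -/

section Garsia

variable {k : Type*} [Field k] {n : ℕ} {ι : Type*}

/-- Idempotents `e`, `f` generating the same right ideal satisfy `e * f = f` and `f * e = e`. The
antipode turns the first identity into `f * e = f`. -/
theorem IsSymmIdempotentOf.eq {N : BraidQuot n} {I : Submodule (BraidAlgOp k n) (QuotAlg k N)}
    {e f : QuotAlg k N} (he : IsSymmIdempotentOf I e) (hf : IsSymmIdempotentOf I f) : e = f := by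
  have key : ∀ e f : QuotAlg k N, IsSymmIdempotentOf I e → IsSymmIdempotentOf I f → e * f = f := by
    intro e f he hf
    have : f ∈ (I : Set (QuotAlg k N)) := hf.2.2 ▸ ⟨f, hf.1.symm⟩
    rw [he.2.2] at this
    obtain ⟨y, hy⟩ := this
    rw [hy, ← mul_assoc, he.1]
  have h := congrArg (HopfAlgebra.antipode k) (key e f he hf)
  rw [monoidAlgebra_antipode_mul, he.2.1, hf.2.1, key f e hf he] at h
  exact h

theorem toQuotAlg_surjective (N : BraidQuot n) : Function.Surjective (toQuotAlg k N) :=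
  fun v => by
  induction v using MonoidAlgebra.induction_linear with
  | zero => exact ⟨0, map_zero _⟩
  | add x y hx hy =>
    obtain ⟨a, rfl⟩ := hx
    obtain ⟨b, rfl⟩ := hy
    exact ⟨a + b, map_add _ _ _⟩
  | single g r =>
    obtain ⟨g, rfl⟩ := QuotientGroup.mk'_surjective _ g
    exact ⟨MonoidAlgebra.single g r, by simp [toQuotAlg]⟩

theorem IsSymmIdempotentOf.mem {N : BraidQuot n} {I : Submodule (BraidAlgOp k n) (QuotAlg k N)}
    {e : QuotAlg k N} (he : IsSymmIdempotentOf I e) : e ∈ I := by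
  rw [← SetLike.mem_coe, he.2.2]
  exact ⟨e, he.1.symm⟩

/-- `M(n)` is the common kernel of left multiplication by the elements `x i`, `i ∈ s`, of the
rational group algebra of the braid group. -/
def BraidedSubseq.IsRatKernel (M : BraidedSubseq k) [CharZero k] (s : Finset ι)
    (x : ι → MonoidAlgebra ℚ (BraidGroup n)) : Prop :=
  ∀ (N : BraidQuot n) (v : QuotAlg k N), v ∈ M.obj N ↔
    ∀ i ∈ s, toQuotAlg k N (MonoidAlgebra.mapRingHom _ (algebraMap ℚ k) (x i)) * v = 0

variable [CharZero k] {M : BraidedSubseq k} {s : Finset ι} {x : ι → MonoidAlgebra ℚ (BraidGroup n)}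

/-- Sums of squares may vanish nontrivially over `k`, so the idempotent is built over `ℚ` and its
scalars are then extended. -/
theorem exists_isKernelIdempotent (N : BraidQuot n) (s : Finset ι)
    (x : ι → MonoidAlgebra ℚ (BraidGroup n)) :
    ∃ e : QuotAlg k N, IsKernelIdempotent s
      (fun i => toQuotAlg k N (MonoidAlgebra.mapRingHom _ (algebraMap ℚ k) (x i))) e := by
  obtain ⟨e, he⟩ := exists_isKernelIdempotent_rat s fun i => toQuotAlg ℚ N (x i)
  refine ⟨MonoidAlgebra.mapRingHom _ (algebraMap ℚ k) e, ?_⟩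
  convert he.map (MonoidAlgebra.mapRingHom _ (algebraMap ℚ k)) (antipode_mapRingHom _) using 2 with i
  exact DFunLike.congr_fun
    (MonoidAlgebra.mapRingHom_comp_mapDomainRingHom (algebraMap ℚ k)
      (QuotientGroup.mk' N.toSubgroup)).symm (x i)

theorem IsKernelIdempotent.isSymmIdempotentOf (hM : M.IsRatKernel s x) {N : BraidQuot n}
    {e : QuotAlg k N} (he : IsKernelIdempotent s
      (fun i => toQuotAlg k N (MonoidAlgebra.mapRingHom _ (algebraMap ℚ k) (x i))) e) :
    IsSymmIdempotentOf (M.obj N) e := by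
  refine ⟨he.mul_self, he.antipode_eq, Set.ext fun v => ?_⟩
  rw [SetLike.mem_coe, hM]
  constructor
  · exact fun hv => ⟨v, (he.mul_eq_self hv).symm⟩
  · rintro ⟨y, rfl⟩ i hi
    rw [← mul_assoc, he.mul_eq_zero i hi, zero_mul]

/-- A common kernel of rational elements has a Garsia element, which is the image of `1` modulo
the left ideals generated by these elements, and which generates. -/
theorem BraidedSubseq.IsRatKernel.exists_garsia (hM : M.IsRatKernel s x) :
    ∃ g : ProLimit (M.pro n), IsGarsiaElement M g ∧
      (∀ N, Submodule.span (BraidAlgOp k n) {g.term N} = ⊤) ∧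
      ∀ N, ∃ a : ι → QuotAlg k N, 1 - (show M.obj N from g.term N).1 = ∑ i ∈ s, a i *
        toQuotAlg k N (MonoidAlgebra.mapRingHom _ (algebraMap ℚ k) (x i)) := by
  choose e he using fun N : BraidQuot n => exists_isKernelIdempotent (k := k) N s x
  have hs : ∀ N, IsSymmIdempotentOf (M.obj N) (e N) := fun N => (he N).isSymmIdempotentOf hM
  have hcompat : ∀ {N N' : BraidQuot n} (h : N ≤ N'), transHom k h (e N) = e N' := by
    intro N N' h
    -- The transition map commutes with antipodes and respects the defining elements, so the image
    -- of `e N` has the property that characterises `e N'`.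
    refine IsSymmIdempotentOf.eq (IsKernelIdempotent.isSymmIdempotentOf hM ?_) (hs N')
    have := (he N).map (transRingHom k h) (antipode_mapDomainRingHom _)
    simp only [transRingHom_toQuotAlg] at this
    exact this
  refine ⟨⟨fun N => (⟨e N, (hs N).mem⟩ : M.obj N), fun {N N'} f => Subtype.ext (hcompat f.le)⟩,
    fun N e' => ⟨fun h => h.eq (hs N), fun h => ?_⟩, fun N => ?_, fun N => (he N).one_sub⟩
  · rw [h]; exact hs N
  · rw [eq_top_iff]
    rintro ⟨v, hv⟩ -
    obtain ⟨b, hb⟩ := toQuotAlg_surjective N v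
    rw [hM] at hv
    refine Submodule.mem_span_singleton.2 ⟨op b, Subtype.ext ?_⟩
    change e N * toQuotAlg k N b = v
    rw [hb, (he N).mul_eq_self hv]

/-- If a ring homomorphism kills the defining elements of the common kernel `M(n)` and the
decomposables, then `M(n)` and its indecomposables are nonzero, and are generated by the Garsia
element. -/
theorem BraidedSubseq.IsRatKernel.main (hM : M.IsRatKernel s x) (C : BraidedSubseq k)
    {K : Type*} [Ring K] [Nontrivial K] (P : IndexFamily n) (φ : QuotAlg k (P.1 n) →+* K)
    (hφ : ∀ i ∈ s, φ (toQuotAlg k _ (MonoidAlgebra.mapRingHom _ (algebraMap ℚ k) (x i))) = 0)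
    (hdec : ∀ v ∈ decomposables C M P, φ v = 0) :
    ¬ IsProZero (M.pro n) ∧ IsProCyclic (M.pro n) ∧ ¬ IsProZero (indec C M n) ∧
      IsProCyclic (indec C M n) ∧
      ∃ g : ProLimit (M.pro n), IsGarsiaElement M g ∧ IsProGenerator (M.pro n) g ∧
        IsProGenerator (indec C M n) (toIndec C M g) ∧
        ∃ P : IndexFamily n, (toIndec C M g).term P ≠ 0 := by
  obtain ⟨g, hg, hgen, hone⟩ := hM.exists_garsia
  -- `1 - g` lies in a left ideal whose generators are killed by `φ`.
  have hφg : φ (show M.obj (P.1 n) from g.term (P.1 n)).1 = 1 := by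
    obtain ⟨a, ha⟩ := hone (P.1 n)
    have := congrArg φ ha
    rw [map_sum, Finset.sum_eq_zero fun i hi => by rw [map_mul, hφ i hi, mul_zero], map_sub,
      map_one, sub_eq_zero] at this
    exact this.symm
  have hne : (toIndec C M g).term P ≠ 0 := by
    intro h
    have h' := (Submodule.Quotient.mk_eq_zero _).1 h
    have := hdec _ (Submodule.mem_comap.1 h')
    exact one_ne_zero (hφg.symm.trans this)
  have hgen1 : IsProGenerator (M.pro n) g :=
    ⟨Set.univ, fun j => ⟨j, trivial, le_rfl⟩, fun N _ => hgen N⟩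
  have hgen2 : IsProGenerator (indec C M n) (toIndec C M g) := by
    refine ⟨Set.univ, fun j => ⟨j, trivial, le_rfl⟩, fun P' _ => ?_⟩
    rw [eq_top_iff]
    intro v _
    obtain ⟨w, rfl⟩ := Submodule.mkQ_surjective
      ((decomposables C M P').submoduleOf (M.obj (P'.1 n))) v
    have hw : ∃ b : BraidAlgOp k n, b • (show M.obj (P'.1 n) from g.term (P'.1 n)) = w := by
      refine Submodule.mem_span_singleton.1 ?_
      have h : Submodule.span (BraidAlgOp k n) {(show M.obj (P'.1 n) from g.term (P'.1 n))} = ⊤ :=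
        hgen (P'.1 n)
      exact h ▸ Submodule.mem_top
    obtain ⟨b, rfl⟩ := hw
    exact Submodule.mem_span_singleton.2 ⟨b, (map_smul _ b _).symm⟩
  refine ⟨fun hz => ?_, ⟨g, hgen1⟩, fun hz => ?_, ⟨_, hgen2⟩, g, hg, hgen1, hgen2, P, hne⟩
  -- The term of `g` at `P.1 n` is the image of its term at `N`, so a zero transition map would
  -- force it to vanish, against `φ g = 1`.
  · obtain ⟨N, f, hf⟩ := hz (P.1 n)
    have h := g.2 f
    have h0 : g.term (P.1 n) = 0 := by
      rw [← show (M.pro n).map f (g.term N) = g.term (P.1 n) from h, hf]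
      rfl
    have h1 : (show M.obj (P.1 n) from g.term (P.1 n)).1 = 0 := congrArg Subtype.val h0
    rw [h1, map_zero] at hφg
    exact zero_ne_one hφg
  · obtain ⟨N, f, hf⟩ := hz P
    apply hne
    rw [← show (indec C M n).map f ((toIndec C M g).term N) = (toIndec C M g).term P from
      (toIndec C M g).2 f, hf]
    rfl

end Garsia

/-! ### Inversions and the length of reduced words -/

section Inversions

/-- The number of inversions of a permutation. -/
def invCount {n : ℕ} (w : Equiv.Perm (Fin n)) : ℕ :=
  (Finset.univ.filter fun x : Fin n × Fin n => x.1 < x.2 ∧ w x.2 < w x.1).card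

theorem invCount_eq_sum {n : ℕ} (w : Equiv.Perm (Fin n)) :
    invCount w = ∑ a, ∑ b, if a < b ∧ w b < w a then 1 else 0 := by
  rw [invCount, Finset.card_filter, Fintype.sum_prod_type]

theorem invCount_one (n : ℕ) : invCount (1 : Equiv.Perm (Fin n)) = 0 := by
  rw [invCount, Finset.card_eq_zero, Finset.filter_eq_empty_iff]
  rintro ⟨a, b⟩ - ⟨h, h'⟩
  exact lt_asymm h h'

theorem invCount_inv {n : ℕ} (w : Equiv.Perm (Fin n)) : invCount w⁻¹ = invCount w := by
  refine Finset.card_bij (fun x _ => (w⁻¹ x.2, w⁻¹ x.1)) ?_ ?_ ?_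
  · rintro ⟨a, b⟩ h
    simpa using And.comm.1 (by simpa using h)
  · rintro ⟨a, b⟩ - ⟨c, d⟩ - h
    simp only [Prod.mk.injEq, EmbeddingLike.apply_eq_iff_eq] at h
    exact Prod.ext h.2 h.1
  · rintro ⟨a, b⟩ h
    refine ⟨(w b, w a), ?_, by simp⟩
    simpa using And.comm.1 (by simpa using h)

theorem adjSwap_mul_self (m j : ℕ) : adjSwap m j * adjSwap m j = 1 := by
  exact (congrArg (· * adjSwap m j) (adjSwap_inv m j).symm).trans (inv_mul_cancel _)

theorem invCount_mul_adjSwap {n j : ℕ} (h : j + 1 < n) (w : Equiv.Perm (Fin n))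
    (hw : w ⟨j, by omega⟩ < w ⟨j + 1, h⟩) : invCount (w * adjSwap n j) = invCount w + 1 := by
  classical
  -- The adjacent transposition reverses the order of the pair `j`, `j + 1` only. As `w` has no
  -- inversion there, exactly one inverted pair is gained.
  have key : ∀ a b : Fin n, (a = ⟨j + 1, h⟩ ∧ b = ⟨j, by omega⟩) ∨ (a < b ∧ w b < w a) ↔
      adjSwap n j a < adjSwap n j b ∧ w b < w a := by
    intro a b
    by_cases hab : a = ⟨j + 1, h⟩ ∧ b = ⟨j, by omega⟩
    · obtain ⟨rfl, rfl⟩ := hab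
      rw [Fin.lt_def (a := adjSwap n j _), adjSwap_val h, adjSwap_val h]
      simpa using hw
    by_cases hba : a = ⟨j, by omega⟩ ∧ b = ⟨j + 1, h⟩
    · obtain ⟨rfl, rfl⟩ := hba
      rw [Fin.lt_def (a := adjSwap n j _), adjSwap_val h, adjSwap_val h]
      simp [hw.not_gt]
    · simp only [hab, false_or]
      refine and_congr_left fun _ => ?_
      simp only [Fin.lt_def, Fin.ext_iff, adjSwap_val h] at hab hba ⊢
      split_ifs <;> omega
  have e : invCount (w * adjSwap n j) =
      (Finset.univ.filter fun x : Fin n × Fin n =>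
        adjSwap n j x.1 < adjSwap n j x.2 ∧ w x.2 < w x.1).card := by
    have hs : ∀ a, adjSwap n j (adjSwap n j a) = a := fun a => by
      rw [← Equiv.Perm.mul_apply, adjSwap_mul_self, Equiv.Perm.one_apply]
    refine Finset.card_bij (fun x _ => (adjSwap n j x.1, adjSwap n j x.2)) ?_ ?_ ?_
    · rintro ⟨a, b⟩ hx
      exact Finset.mem_filter.2 ⟨Finset.mem_univ _, by simpa [hs] using (Finset.mem_filter.1 hx).2⟩
    · rintro ⟨a, b⟩ - ⟨c, d⟩ - hx
      simpa using hx
    · rintro ⟨a, b⟩ hx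
      exact ⟨(adjSwap n j a, adjSwap n j b),
        Finset.mem_filter.2 ⟨Finset.mem_univ _, by simpa [hs] using (Finset.mem_filter.1 hx).2⟩,
        by simp [hs]⟩
  have e' : (Finset.univ.filter fun x : Fin n × Fin n =>
        adjSwap n j x.1 < adjSwap n j x.2 ∧ w x.2 < w x.1) =
      insert (⟨j + 1, h⟩, ⟨j, by omega⟩)
        (Finset.univ.filter fun x : Fin n × Fin n => x.1 < x.2 ∧ w x.2 < w x.1) := by
    ext ⟨a, b⟩
    simp [← key]
  rw [e, e', Finset.card_insert_of_notMem (by simp), invCount]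

theorem invCount_mul_adjSwap_of_gt {n j : ℕ} (h : j + 1 < n) (w : Equiv.Perm (Fin n))
    (hw : w ⟨j + 1, h⟩ < w ⟨j, by omega⟩) : invCount w = invCount (w * adjSwap n j) + 1 := by
  have h1 : adjSwap n j ⟨j, by omega⟩ = ⟨j + 1, h⟩ := by simp [Fin.ext_iff, adjSwap_val h]
  have h2 : adjSwap n j ⟨j + 1, h⟩ = ⟨j, by omega⟩ := by simp [Fin.ext_iff, adjSwap_val h]
  rw [← invCount_mul_adjSwap h]
  · rw [mul_assoc, adjSwap_mul_self, mul_one]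
  · simpa [h1, h2] using hw

/-- Each further letter changes the inversion number by exactly one, up or down. -/
theorem invCount_prod_le {n : ℕ} (l : List (Fin (n - 1))) :
    invCount (l.map fun j : Fin (n - 1) => adjSwap n j).prod ≤ l.length := by
  induction l using List.reverseRecOn with
  | nil => simp [invCount_one]
  | append_singleton l j ih =>
    have h : (j : ℕ) + 1 < n := by omega
    rw [List.map_append, List.prod_append, List.map_singleton, List.prod_singleton,
      List.length_append, List.length_singleton]
    set w := (l.map fun j : Fin (n - 1) => adjSwap n j).prod
    rcases lt_trichotomy (w ⟨j, by omega⟩) (w ⟨j + 1, h⟩) with hw | hw | hw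
    · rw [invCount_mul_adjSwap h w hw]
      omega
    · simp at hw
    · have := invCount_mul_adjSwap_of_gt h w hw
      omega

theorem exists_word_length_eq_invCount {n : ℕ} (w : Equiv.Perm (Fin n)) :
    ∃ l : List (Fin (n - 1)),
      (l.map fun j : Fin (n - 1) => adjSwap n j).prod = w ∧ l.length = invCount w := by
  induction hm : invCount w generalizing w with
  | zero =>
    refine ⟨[], ?_, rfl⟩
    rw [invCount, Finset.card_eq_zero, Finset.filter_eq_empty_iff] at hm
    refine ((Equiv.Perm.monotone_iff w).1 fun a b hab => ?_).symm
    rcases hab.eq_or_lt with rfl | hab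
    · exact le_rfl
    · exact not_lt.1 fun h => hm (Finset.mem_univ (a, b)) ⟨hab, h⟩
  | succ m ih =>
    -- A permutation without descents is monotone, hence the identity, which has no inversions.
    -- Removing a descent lowers the count by one.
    obtain ⟨j, h, hw⟩ : ∃ (j : ℕ) (h : j + 1 < n), w ⟨j + 1, h⟩ < w ⟨j, by omega⟩ := by
      by_contra! hcon
      have : Monotone w := by
        match n, w, hcon with
        | 0, w, _ => exact fun a => a.elim0
        | n + 1, w, hcon =>
          exact Fin.monotone_iff_le_succ.2 fun i => hcon i (by omega)
      rw [(Equiv.Perm.monotone_iff w).1 this, invCount_one] at hm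
      exact absurd hm (by omega)
    have hm' := invCount_mul_adjSwap_of_gt h w hw
    obtain ⟨l, hl, hl'⟩ := ih (w * adjSwap n j) (by omega)
    refine ⟨l ++ [⟨j, by omega⟩], ?_, by simp [hl']⟩
    rw [List.map_append, List.prod_append, hl, List.map_singleton, List.prod_singleton, mul_assoc]
    rw [adjSwap_mul_self, mul_one]

/-- In `IsReducedWord` and `matsumotoLift` the list of letters is coerced to `List ℕ` by a monadic
bind; this restores an ordinary `map`. -/
theorem List.bind_pure_val_eq_map {m : ℕ} (l : List (Fin m)) :
    (do let a ← l; pure (a : ℕ)) = l.map Fin.val := by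
  simp [List.map_eq_flatMap]

theorem IsReducedWord.length_eq {n : ℕ} {w : Equiv.Perm (Fin n)} {l : List (Fin (n - 1))}
    (h : IsReducedWord w l) : l.length = invCount w := by
  obtain ⟨l', h1, h2⟩ := exists_word_length_eq_invCount w
  simp only [IsReducedWord, List.bind_pure_val_eq_map, List.map_map, Function.comp_def] at h
  exact le_antisymm (h2 ▸ h.2 l' h1) (h.1 ▸ invCount_prod_le l)

end Inversions

/-! ### Inversion generating functions: `q`-factorials and `q`-binomials -/

section GeneratingFunctions

variable {K : Type*} [CommRing K] (q : K)

/-- The generating function `∑ q ^ inv(w)` of inversions. -/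
def invSum (n : ℕ) : K := ∑ w : Equiv.Perm (Fin n), q ^ invCount w

open Classical in
/-- The generating function of inversions of the `(p, n - p)`-unshuffles. -/
noncomputable def unshuffleInvSum (n p : ℕ) : K :=
  ∑ w : Equiv.Perm (Fin n) with IsUnshuffle p w, q ^ invCount w

theorem invSum_zero : invSum q 0 = 1 := by
  simp [invSum, invCount]

/-- The permutation of `Fin (n + 1)` that sends `0` to `j` and is order isomorphic to `e` on the
remaining elements. -/
def consPerm {n : ℕ} (j : Fin (n + 1)) (e : Equiv.Perm (Fin n)) : Equiv.Perm (Fin (n + 1)) :=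
  j.cycleRange.symm * Equiv.Perm.decomposeFin.symm (0, e)

theorem consPerm_zero {n : ℕ} (j : Fin (n + 1)) (e : Equiv.Perm (Fin n)) : consPerm j e 0 = j := by
  simp [consPerm]

theorem consPerm_succ {n : ℕ} (j : Fin (n + 1)) (e : Equiv.Perm (Fin n)) (a : Fin n) :
    consPerm j e a.succ = j.succAbove (e a) := by
  simp [consPerm]

/-- The first entry `j` is inverted with exactly the `j` smaller values; among the remaining entries
only the relative order matters. -/
theorem invCount_consPerm {n : ℕ} (j : Fin (n + 1)) (e : Equiv.Perm (Fin n)) :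
    invCount (consPerm j e) = j + invCount e := by
  rw [invCount_eq_sum, invCount_eq_sum, Fin.sum_univ_succ]
  congr 1
  · rw [Fin.sum_univ_succ]
    simp only [consPerm_zero, consPerm_succ, Fin.succ_pos, true_and, lt_irrefl,
      Fin.succAbove_lt_iff_castSucc_lt]
    rw [Equiv.sum_comp e fun b : Fin n => if b.castSucc < j then 1 else 0, ← Finset.card_filter]
    simp only [Fin.lt_def, Fin.val_castSucc]
    rw [if_neg (by simp), zero_add, Fin.card_filter_val_lt]
    omega
  · refine Finset.sum_congr rfl fun a _ => ?_
    rw [Fin.sum_univ_succ]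
    simp [consPerm_succ]

theorem consPerm_bijective (n : ℕ) :
    Function.Bijective fun x : Fin (n + 1) × Equiv.Perm (Fin n) => consPerm x.1 x.2 := by
  rw [Fintype.bijective_iff_injective_and_card]
  constructor
  · rintro ⟨j, e⟩ ⟨j', e'⟩ h
    dsimp only at h
    have hj : j = j' := by rw [← consPerm_zero j e, h, consPerm_zero]
    subst hj
    refine Prod.ext rfl (Equiv.ext fun a => ?_)
    have := DFunLike.congr_fun h a.succ
    rw [consPerm_succ, consPerm_succ] at this
    exact Fin.succAbove_right_injective this
  · simp [Fintype.card_perm, Nat.factorial_succ]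

theorem invSum_succ (n : ℕ) : invSum q (n + 1) = (∑ j ∈ Finset.range (n + 1), q ^ j) * invSum q n := by
  rw [invSum, ← (consPerm_bijective n).sum_comp, Fintype.sum_prod_type, Finset.sum_range,
    Finset.sum_mul]
  refine Finset.sum_congr rfl fun j _ => ?_
  rw [invSum, Finset.mul_sum]
  refine Finset.sum_congr rfl fun e _ => ?_
  rw [invCount_consPerm, pow_add]

/-- The juxtaposition of two permutations. -/
def juxtPerm {p r : ℕ} (u : Equiv.Perm (Fin p)) (v : Equiv.Perm (Fin r)) :
    Equiv.Perm (Fin (p + r)) :=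
  finSumFinEquiv.permCongr (Equiv.Perm.sumCongr u v)

theorem juxtPerm_castAdd {p r : ℕ} (u : Equiv.Perm (Fin p)) (v : Equiv.Perm (Fin r)) (a : Fin p) :
    juxtPerm u v (Fin.castAdd r a) = Fin.castAdd r (u a) := by
  simp [juxtPerm, Equiv.permCongr_apply]

theorem juxtPerm_natAdd {p r : ℕ} (u : Equiv.Perm (Fin p)) (v : Equiv.Perm (Fin r)) (a : Fin r) :
    juxtPerm u v (Fin.natAdd p a) = Fin.natAdd p (v a) := by
  simp [juxtPerm, Equiv.permCongr_apply]

theorem juxtPerm_mul {p r : ℕ} (u u' : Equiv.Perm (Fin p)) (v v' : Equiv.Perm (Fin r)) :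
    juxtPerm u v * juxtPerm u' v' = juxtPerm (u * u') (v * v') := by
  refine Equiv.ext fun a => ?_
  induction a using Fin.addCases <;> simp [juxtPerm_castAdd, juxtPerm_natAdd]

theorem juxtPerm_one (p r : ℕ) :
    juxtPerm (1 : Equiv.Perm (Fin p)) (1 : Equiv.Perm (Fin r)) = 1 := by
  refine Equiv.ext fun a => ?_
  induction a using Fin.addCases <;> simp [juxtPerm_castAdd, juxtPerm_natAdd]

theorem isUnshuffle_iff {p r : ℕ} (w : Equiv.Perm (Fin (p + r))) : IsUnshuffle p w⁻¹ ↔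
    StrictMono (w ∘ Fin.castAdd r) ∧ StrictMono (w ∘ Fin.natAdd p) := by
  constructor
  · intro h
    exact ⟨fun a b hab => h _ _ ((Fin.strictMono_castAdd r) hab) (.inl (by simp)),
      fun a b hab => h _ _ (by simpa using hab) (.inr (by simp))⟩
  · rintro ⟨h1, h2⟩ i j hij hp
    rw [inv_inv]
    induction i using Fin.addCases with
    | left a =>
      induction j using Fin.addCases with
      | left b => exact h1 ((Fin.strictMono_castAdd r).lt_iff_lt.1 hij)
      | right b => simp at hp; omega
    | right a =>
      induction j using Fin.addCases with
      | left b => simp [Fin.lt_def] at hij; omega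
      | right b => exact h2 (by simpa using hij)

theorem invCount_add {p r : ℕ} (w : Equiv.Perm (Fin (p + r))) : invCount w =
    (∑ a : Fin p, ∑ b : Fin p,
      if a < b ∧ w (Fin.castAdd r b) < w (Fin.castAdd r a) then 1 else 0) +
    (∑ a : Fin p, ∑ b : Fin r, if w (Fin.natAdd p b) < w (Fin.castAdd r a) then 1 else 0) +
    (∑ a : Fin r, ∑ b : Fin r,
      if a < b ∧ w (Fin.natAdd p b) < w (Fin.natAdd p a) then 1 else 0) := by
  rw [invCount_eq_sum, Fin.sum_univ_add]
  simp only [Fin.sum_univ_add, Finset.sum_add_distrib]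
  have h1 : ∀ (a : Fin p) (b : Fin r), Fin.castAdd r a < Fin.natAdd p b := fun a b => by
    rw [Fin.lt_def, Fin.val_castAdd, Fin.val_natAdd]; omega
  have h2 : ∀ (a : Fin p) (b : Fin r), ¬ Fin.natAdd p b < Fin.castAdd r a :=
    fun a b => (h1 a b).not_gt
  have h3 : ∀ a b : Fin p, Fin.castAdd r a < Fin.castAdd r b ↔ a < b :=
    fun a b => (Fin.strictMono_castAdd r).lt_iff_lt
  simp only [h1, h2, h3, Fin.natAdd_lt_natAdd_iff, true_and, false_and, if_false,
    Finset.sum_const_zero, zero_add]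

/-- Permuting positions inside the two blocks does not change the number of inversions between
blocks, and an increasing `w` contributes none inside them. -/
theorem invCount_mul_juxtPerm {p r : ℕ} {w : Equiv.Perm (Fin (p + r))}
    (hw : IsUnshuffle p w⁻¹) (u : Equiv.Perm (Fin p)) (v : Equiv.Perm (Fin r)) :
    invCount (w * juxtPerm u v) = invCount w + invCount u + invCount v := by
  obtain ⟨h1, h2⟩ := (isUnshuffle_iff w).1 hw
  have h1' : ∀ a b, w (Fin.castAdd r a) < w (Fin.castAdd r b) ↔ a < b := fun a b => h1.lt_iff_lt
  have h2' : ∀ a b, w (Fin.natAdd p a) < w (Fin.natAdd p b) ↔ a < b := fun a b => h2.lt_iff_lt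
  have h0 : ∀ {m : ℕ} (a b : Fin m), ¬ (a < b ∧ b < a) := fun a b h => lt_asymm h.1 h.2
  rw [invCount_add, invCount_add w, invCount_eq_sum u, invCount_eq_sum v]
  simp only [Equiv.Perm.mul_apply, juxtPerm_castAdd, juxtPerm_natAdd, h1', h2', h0, if_false,
    Finset.sum_const_zero, add_zero, zero_add]
  rw [Equiv.sum_comp u fun a => ∑ b, if w (Fin.natAdd p (v b)) < w (Fin.castAdd r a) then 1 else 0]
  simp only [fun a => Equiv.sum_comp v fun b =>
    if w (Fin.natAdd p b) < w (Fin.castAdd r a) then 1 else 0]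
  ring

/-- Inverses of unshuffles are the minimal length representatives of the cosets of `S_p × S_r`, and
lengths add along the coset decomposition. So the unshuffle sum is a `q`-binomial coefficient, here
in a form free of division. -/
theorem invSum_add (p r : ℕ) :
    invSum q (p + r) = unshuffleInvSum q (p + r) p * invSum q p * invSum q r := by
  classical
  symm
  simp only [invSum, unshuffleInvSum]
  rw [mul_assoc, Fintype.sum_mul_sum, ← Fintype.sum_prod_type', Finset.sum_mul_sum,
    ← Finset.sum_product']
  refine Finset.sum_bij (fun x _ => x.1⁻¹ * juxtPerm x.2.1 x.2.2) (fun _ _ => Finset.mem_univ _)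
    ?_ ?_ ?_
  · rintro ⟨w, u, v⟩ hw ⟨w', u', v'⟩ hw' h
    simp only [Finset.mem_product, Finset.mem_filter, Finset.mem_univ, true_and, and_true] at hw hw'
    dsimp only at h
    obtain ⟨h1, h2⟩ := (isUnshuffle_iff w⁻¹).1 (by rwa [inv_inv])
    obtain ⟨h1', h2'⟩ := (isUnshuffle_iff w'⁻¹).1 (by rwa [inv_inv])
    have hc : w⁻¹ * juxtPerm (u * u'⁻¹) (v * v'⁻¹) = w'⁻¹ := by
      rw [← juxtPerm_mul, ← mul_assoc, h, mul_assoc, juxtPerm_mul, mul_inv_cancel, mul_inv_cancel,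
        juxtPerm_one, mul_one]
    -- Both coset representatives are increasing on the block, and an increasing sequence with
    -- distinct values has only the trivial increasing rearrangement.
    have hu : u * u'⁻¹ = 1 := by
      refine Equiv.ext fun a => Fin.castAdd_injective p r (w⁻¹.injective ?_)
      have e : (⇑w⁻¹ ∘ Fin.castAdd r) ∘ (u * u'⁻¹) = ⇑w'⁻¹ ∘ Fin.castAdd r := by
        rw [← hc]
        funext b
        simp [juxtPerm_castAdd]
      exact congrFun (Tuple.unique_monotone (f := ⇑w⁻¹ ∘ Fin.castAdd r) (σ := u * u'⁻¹) (τ := 1)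
        (by rw [e]; exact h1'.monotone) h1.monotone) a
    have hv : v * v'⁻¹ = 1 := by
      refine Equiv.ext fun a => Fin.natAdd_injective r p (w⁻¹.injective ?_)
      have e : (⇑w⁻¹ ∘ Fin.natAdd p) ∘ (v * v'⁻¹) = ⇑w'⁻¹ ∘ Fin.natAdd p := by
        rw [← hc]
        funext b
        simp [juxtPerm_natAdd]
      exact congrFun (Tuple.unique_monotone (f := ⇑w⁻¹ ∘ Fin.natAdd p) (σ := v * v'⁻¹) (τ := 1)
        (by rw [e]; exact h2'.monotone) h2.monotone) a
    rw [hu, hv, juxtPerm_one, mul_one] at hc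
    rw [inv_injective hc, mul_inv_eq_one.1 hu, mul_inv_eq_one.1 hv]
  · intro w _
    -- Sorting the values of `w` within each block produces the representative of its coset.
    let u := Tuple.sort (w ∘ Fin.castAdd r)
    let v := Tuple.sort (w ∘ Fin.natAdd p)
    refine ⟨((w * juxtPerm u v)⁻¹, u⁻¹, v⁻¹), ?_, ?_⟩
    · simp only [Finset.mem_product, Finset.mem_filter, Finset.mem_univ, true_and, and_true]
      refine (isUnshuffle_iff _).2 ⟨?_, ?_⟩
      · refine Monotone.strictMono_of_injective ?_
          ((w * juxtPerm u v).injective.comp (Fin.castAdd_injective p r))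
        convert Tuple.monotone_sort (w ∘ Fin.castAdd r) using 1
        funext b
        simp [juxtPerm_castAdd, u]
      · refine Monotone.strictMono_of_injective ?_
          ((w * juxtPerm u v).injective.comp (Fin.natAdd_injective r p))
        convert Tuple.monotone_sort (w ∘ Fin.natAdd p) using 1
        funext b
        simp [juxtPerm_natAdd, v]
    · rw [inv_inv, mul_assoc, juxtPerm_mul, mul_inv_cancel, mul_inv_cancel, juxtPerm_one, mul_one]
  · rintro ⟨w, u, v⟩ hw
    simp only [Finset.mem_product, Finset.mem_filter, Finset.mem_univ, true_and, and_true] at hw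
    rw [invCount_mul_juxtPerm (by rwa [inv_inv]), invCount_inv, pow_add, pow_add, mul_assoc]

end GeneratingFunctions

/-! ### Characters of the braid groups and their effect on compositions -/

section BraidCharacter

theorem braidLift_of {n : ℕ} {G : Type*} [Group G] (f : ℕ → G)
    (hb : ∀ j, j + 1 < n - 1 → f j * f (j + 1) * f j = f (j + 1) * f j * f (j + 1))
    (hc : ∀ i j, i + 1 < j → j < n - 1 → f i * f j = f j * f i) (j : Fin (n - 1)) :
    braidLift f hb hc (PresentedGroup.of j) = f j := by
  rw [braidLift, PresentedGroup.toGroup.of]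

variable {G : Type*} [CommGroup G]

/-- The character of the braid group that sends each generator to `q`. -/
def braidChar (q : G) (n : ℕ) : BraidGroup n →* G :=
  braidLift (fun _ => q) (fun _ _ => rfl) (fun _ _ _ _ => rfl)

theorem braidChar_of (q : G) {n : ℕ} (j : Fin (n - 1)) :
    braidChar q n (PresentedGroup.of j) = q :=
  braidLift_of _ _ _ _

theorem braidChar_braidGen (q : G) {n j : ℕ} (h : j < n - 1) :
    braidChar q n (braidGen n j) = q := by
  rw [braidGen, dif_pos h, braidChar_of]

/-- The lift is a product along a word of minimal length, so only the length of the chosen word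
counts. -/
theorem braidChar_matsumotoLift (q : G) {n : ℕ} (τ : Equiv.Perm (Fin n)) :
    braidChar q n (matsumotoLift τ) = q ^ invCount τ := by
  rw [← (exists_isReducedWord τ).choose_spec.length_eq, matsumotoLift, map_list_prod,
    List.bind_pure_val_eq_map, List.map_map, List.map_map]
  refine (List.prod_eq_pow_card _ q fun x hx => ?_).trans (by rw [List.length_map])
  obtain ⟨j, -, rfl⟩ := List.mem_map.1 hx
  exact braidChar_braidGen q j.2

/-- Insertion sends generators to generators, all of which have the same value in every arity. -/
theorem braidChar_insertHom (q : G) {m l n : ℕ} (h : m + l = n + 1) (i : Fin m)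
    (ρ : BraidGroup l) : braidChar q n (insertHom h i ρ) = braidChar q l ρ := by
  have : (braidChar q n).comp (insertHom h i) = braidChar q l := by
    refine PresentedGroup.ext fun j => ?_
    rw [MonoidHom.comp_apply, braidChar_of]
    refine (congrArg _ (braidLift_of _ _ _ _)).trans (braidChar_braidGen q ?_)
    omega
  exact DFunLike.congr_fun this ρ

variable {k K : Type*} [Field k] [Field K] [Algebra k K] (ψ : G →* K) (q : G)

/-- The character of the group algebra of a finite quotient of the braid group that is induced by
`braidChar q`. -/
noncomputable def quotChar {n : ℕ} (N : BraidQuot n) (hN : N.toSubgroup ≤ (braidChar q n).ker) :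
    QuotAlg k N →ₐ[k] K :=
  MonoidAlgebra.lift k K _ (ψ.comp (QuotientGroup.lift N.toSubgroup (braidChar q n) hN))

variable {n : ℕ} {N : BraidQuot n} (hN : N.toSubgroup ≤ (braidChar q n).ker)

theorem quotChar_single (g : BraidGroup n) (a : k) :
    quotChar ψ q N hN (MonoidAlgebra.single (g : BraidGroup n ⧸ N.toSubgroup) a) =
      a • ψ (braidChar q n g) := by
  simp [quotChar, MonoidAlgebra.lift_single]

theorem quotChar_symmetrizer :
    quotChar ψ q N hN (toQuotAlg k N (symmetrizer k n)) = invSum (ψ q) n := by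
  rw [symmetrizer, map_sum, map_sum, invSum]
  refine Finset.sum_congr rfl fun τ _ => ?_
  rw [toQuotAlg, MonoidAlgebra.mapDomainRingHom_apply, MonoidAlgebra.mapDomain_single]
  refine (quotChar_single ψ q hN _ _).trans ?_
  rw [one_smul, braidChar_matsumotoLift, map_pow]

theorem quotChar_unshuffleSum (p : ℕ) :
    quotChar ψ q N hN (toQuotAlg k N (unshuffleSum k n p)) = unshuffleInvSum (ψ q) n p := by
  rw [unshuffleSum, map_sum, map_sum, unshuffleInvSum]
  refine Finset.sum_congr rfl fun τ _ => ?_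
  rw [toQuotAlg, MonoidAlgebra.mapDomainRingHom_apply, MonoidAlgebra.mapDomain_single]
  refine (quotChar_single ψ q hN _ _).trans ?_
  rw [one_smul, braidChar_matsumotoLift, map_pow]

theorem quotChar_eq_sum (v : QuotAlg k N) : quotChar ψ q N hN v =
    v.coeff.sum fun y b => b • ψ (QuotientGroup.lift N.toSubgroup (braidChar q n) hN y) := by
  rw [quotChar, MonoidAlgebra.lift_apply]
  rfl

/-- The character of a composition is divisible by that of the inner factor. -/
theorem quotChar_circ_eq_zero {m l : ℕ} {h : m + l = n + 1} {i : Fin m} {P : BraidQuot m}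
    {Q : BraidQuot l} (hA : Admissible h i P Q N) (hQ : Q.toSubgroup ≤ (braidChar q l).ker)
    (α : QuotAlg k P) {β : QuotAlg k Q} (hβ : quotChar ψ q Q hQ β = 0) :
    quotChar ψ q N hN (circ hA α β) = 0 := by
  rw [circ, Finsupp.sum, map_sum]
  refine Finset.sum_eq_zero fun x _ => ?_
  obtain ⟨γ, rfl⟩ := QuotientGroup.mk_surjective x
  rw [Finsupp.sum, map_sum]
  -- For fixed `γ` the cabling factor does not depend on the inner braid, so it can be pulled out of
  -- the sum over `y`, which leaves the character of `β`.
  have key : ∀ y b, quotChar ψ q N hN (MonoidAlgebra.single (cableQuot hA γ y) (α.coeff γ * b)) =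
      α.coeff γ • ψ (braidChar q n ((cableHom h γ).left ((cableHom h γ).right i))) *
        (b • ψ (QuotientGroup.lift Q.toSubgroup (braidChar q l) hQ y)) := by
    intro y b
    obtain ⟨ρ, rfl⟩ := QuotientGroup.mk_surjective y
    refine (quotChar_single ψ q hN (cable h i γ ρ) _).trans ?_
    rw [cable, map_mul, braidChar_insertHom, map_mul, QuotientGroup.lift_mk, smul_mul_smul_comm]
  rw [Finset.sum_congr rfl fun y _ => key y _, ← Finset.mul_sum]
  rw [quotChar_eq_sum, Finsupp.sum] at hβ
  rw [hβ, mul_zero]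

/-- A character of the group algebra kills the decomposables if it kills the module in all smaller
arities. -/
theorem quotChar_decomposables (C M : BraidedSubseq k) (P : IndexFamily n)
    (hP : ∀ l, (P.1 l).toSubgroup ≤ (braidChar q l).ker)
    (hM : ∀ l, 2 ≤ l → l < n → ∀ β ∈ M.obj (P.1 l), quotChar ψ q _ (hP l) β = 0)
    (v : QuotAlg k (P.1 n)) (hv : v ∈ decomposables C M P) : quotChar ψ q _ (hP n) v = 0 := by
  induction hv using Submodule.span_induction with
  | mem x hx =>
    obtain ⟨m, l, h, hm, hl, i, α, -, β, hβ, rfl⟩ := hx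
    exact quotChar_circ_eq_zero ψ q _ _ (hP l) α (hM l hl (by omega) β hβ)
  | zero => exact map_zero _
  | add x y _ _ hx hy => rw [map_add, hx, hy, add_zero]
  | smul a x _ hx => rw [quotAlg_smul_def, map_mul, hx, zero_mul]

end BraidCharacter

/-! ### Evaluation at a primitive root of unity -/

section RootOfUnity

variable {K : Type*} [Field K] {n : ℕ} {ζ : K}

/-- Each factor is a geometric sum of fewer than `n` powers of `ζ`; its vanishing would give `ζ` an
order smaller than `n`. -/
theorem invSum_ne_zero (hζ : IsPrimitiveRoot ζ n) (l : ℕ) (hl : l < n) : invSum ζ l ≠ 0 := by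
  induction l with
  | zero => rw [invSum_zero]; exact one_ne_zero
  | succ l ih =>
    rw [invSum_succ]
    refine mul_ne_zero (fun h => ?_) (ih (by omega))
    have := geom_sum_mul ζ (l + 1)
    rw [h, zero_mul] at this
    exact hζ.pow_ne_one_of_pos_of_lt (by omega) hl (sub_eq_zero.1 this.symm)

theorem invSum_eq_zero (hζ : IsPrimitiveRoot ζ n) (hn : 2 ≤ n) : invSum ζ n = 0 := by
  obtain ⟨m, rfl⟩ : ∃ m, n = m + 1 := ⟨n - 1, by omega⟩
  rw [invSum_succ, hζ.geom_sum_eq_zero (by omega), zero_mul]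

/-- In the factorization `invSum_add` the left side vanishes, while the two smaller `q`-factorials
on the right do not. -/
theorem unshuffleInvSum_eq_zero (hζ : IsPrimitiveRoot ζ n) {p : ℕ} (hp : 0 < p) (hpn : p < n) :
    unshuffleInvSum ζ n p = 0 := by
  obtain ⟨r, rfl⟩ : ∃ r, n = p + r := ⟨n - p, by omega⟩
  have h := invSum_add ζ p r
  rw [invSum_eq_zero hζ (by omega)] at h
  simpa [invSum_ne_zero hζ p hpn, invSum_ne_zero hζ r (by omega)] using h.symm

theorem unshuffleInvSum_ne_zero (hζ : IsPrimitiveRoot ζ n) {l p : ℕ} (hp : p ≤ l) (hl : l < n) :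
    unshuffleInvSum ζ l p ≠ 0 := by
  obtain ⟨r, rfl⟩ : ∃ r, l = p + r := ⟨l - p, by omega⟩
  intro h
  apply invSum_ne_zero hζ _ hl
  rw [invSum_add, h, zero_mul, zero_mul]

end RootOfUnity

/-! ### The two kernels and the proof of the theorem -/

section Main

variable (k : Type*) [Field k] [CharZero k]

theorem mapRingHom_symmetrizer (n : ℕ) :
    MonoidAlgebra.mapRingHom _ (algebraMap ℚ k) (symmetrizer ℚ n) = symmetrizer k n := by
  simp [symmetrizer]

theorem mapRingHom_unshuffleSum (n p : ℕ) :
    MonoidAlgebra.mapRingHom _ (algebraMap ℚ k) (unshuffleSum ℚ n p) = unshuffleSum k n p := by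
  simp [unshuffleSum]

theorem brPrim_isRatKernel {n : ℕ} (hn : 2 ≤ n) :
    (BraidedSubseq.brPrim k).IsRatKernel (Finset.Ioo 0 n) (unshuffleSum ℚ n) := by
  intro N v
  simp only [BraidedSubseq.brPrim, if_neg (show ¬ n ≤ 1 by omega), Submodule.mem_iInf,
    LinearMap.mem_ker, Finset.mem_Ioo, mapRingHom_unshuffleSum]
  rfl

theorem woronowicz_isRatKernel (n : ℕ) :
    (BraidedSubseq.woronowicz k).IsRatKernel {()} (fun _ => symmetrizer ℚ n) := by
  intro N v
  simp only [BraidedSubseq.woronowicz, LinearMap.mem_ker, Finset.mem_singleton,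
    mapRingHom_symmetrizer, forall_const]
  rfl

/-- The characters of the braid groups that send the generators to a root of unity factor through
the finite quotients given by some member of `IndexFamily n`. -/
theorem exists_indexFamily_le_ker_braidChar {K : Type*} [Field K] {n : ℕ} [NeZero n]
    (q : rootsOfUnity n K) :
    ∃ P : IndexFamily n, ∀ l, (P.1 l).toSubgroup ≤ (braidChar q l).ker := by
  -- The kernels have finite index because the character takes values in the finite group of `n`-th
  -- roots of unity.
  obtain ⟨P, hP, -⟩ := exists_indexFamily_le (n := n) fun l => .ofSubgroup (braidChar q l).ker
  exact ⟨P, fun l => hP l⟩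

end Main

theorem mainTheorem9 (k : Type*) [Field k] [CharZero k] (n : ℕ) (hn : 2 ≤ n) :
    (¬ IsProZero ((BraidedSubseq.brPrim k).pro n) ∧
      IsProCyclic ((BraidedSubseq.brPrim k).pro n) ∧
      ¬ IsProZero (indec (BraidedSubseq.brPrim k) (BraidedSubseq.brPrim k) n) ∧
      IsProCyclic (indec (BraidedSubseq.brPrim k) (BraidedSubseq.brPrim k) n) ∧
      ∃ g : ProLimit ((BraidedSubseq.brPrim k).pro n),
        IsGarsiaElement (BraidedSubseq.brPrim k) g ∧
        IsProGenerator ((BraidedSubseq.brPrim k).pro n) g ∧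
        IsProGenerator (indec (BraidedSubseq.brPrim k) (BraidedSubseq.brPrim k) n)
          (toIndec (BraidedSubseq.brPrim k) (BraidedSubseq.brPrim k) g) ∧
        ∃ P : IndexFamily n,
          (toIndec (BraidedSubseq.brPrim k) (BraidedSubseq.brPrim k) g).term P ≠ 0) ∧
    (¬ IsProZero ((BraidedSubseq.woronowicz k).pro n) ∧
      IsProCyclic ((BraidedSubseq.woronowicz k).pro n) ∧
      ¬ IsProZero (indec (BraidedSubseq.brAssGtOne k) (BraidedSubseq.woronowicz k) n) ∧
      IsProCyclic (indec (BraidedSubseq.brAssGtOne k) (BraidedSubseq.woronowicz k) n) ∧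
      ∃ g : ProLimit ((BraidedSubseq.woronowicz k).pro n),
        IsGarsiaElement (BraidedSubseq.woronowicz k) g ∧
        IsProGenerator ((BraidedSubseq.woronowicz k).pro n) g ∧
        IsProGenerator (indec (BraidedSubseq.brAssGtOne k) (BraidedSubseq.woronowicz k) n)
          (toIndec (BraidedSubseq.brAssGtOne k) (BraidedSubseq.woronowicz k) g) ∧
        ∃ P : IndexFamily n,
          (toIndec (BraidedSubseq.brAssGtOne k) (BraidedSubseq.woronowicz k) g).term P ≠ 0) := by
  have : NeZero n := ⟨by omega⟩
  have := AlgebraicClosure.instCharZero k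
  -- The field `k` need not contain such a root; a character with values in an extension detects
  -- nonvanishing just as well.
  obtain ⟨ζ, hζ⟩ := HasEnoughRootsOfUnity.exists_primitiveRoot (AlgebraicClosure k) n
  let q : rootsOfUnity n (AlgebraicClosure k) := hζ.toRootsOfUnity
  let ψ : rootsOfUnity n (AlgebraicClosure k) →* AlgebraicClosure k :=
    (Units.coeHom _).comp (rootsOfUnity n _).subtype
  have hq : ψ q = ζ := rfl
  obtain ⟨P, hP⟩ := exists_indexFamily_le_ker_braidChar q
  constructor
  · refine (brPrim_isRatKernel k hn).main _ P (quotChar ψ q _ (hP n)).toRingHom (fun p hp => ?_)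
      (quotChar_decomposables ψ q _ _ P hP fun l hl hln β hβ => ?_)
    · rw [Finset.mem_Ioo] at hp
      rw [mapRingHom_unshuffleSum]
      exact (quotChar_unshuffleSum ψ q (hP n) p).trans (unshuffleInvSum_eq_zero hζ hp.1 hp.2)
    -- A single annihilating shuffle element with nonzero character suffices, and `p = 1` is
    -- available in every arity `l ≥ 2`.
    · have h := (brPrim_isRatKernel k hl _ β).1 hβ 1 (by rw [Finset.mem_Ioo]; omega)
      have h' := congrArg (quotChar ψ q _ (hP l)) h
      rw [map_mul, map_zero, mapRingHom_unshuffleSum, quotChar_unshuffleSum] at h'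
      exact (mul_eq_zero.1 h').resolve_left (unshuffleInvSum_ne_zero hζ (by omega) hln)
  · refine (woronowicz_isRatKernel k n).main _ P (quotChar ψ q _ (hP n)).toRingHom (fun p hp => ?_)
      (quotChar_decomposables ψ q _ _ P hP fun l hl hln β hβ => ?_)
    · rw [mapRingHom_symmetrizer]
      exact (quotChar_symmetrizer ψ q (hP n)).trans (invSum_eq_zero hζ hn)
    · have h := (woronowicz_isRatKernel k l _ β).1 hβ () (by simp)
      have h' := congrArg (quotChar ψ q _ (hP l)) h
      rw [map_mul, map_zero, mapRingHom_symmetrizer, quotChar_symmetrizer] at h'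
      exact (mul_eq_zero.1 h').resolve_left (invSum_ne_zero hζ l hln)
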